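/- Let $L, T > 0$. Consider the heat equation $\partial_t u - \partial_{xx} u = 0$ in $(0,T)\times(-L,L)$ with boundary conditions $u(t,-L) = v_-(t)$, $u(t,L) = v_+(t)$ for $t \in (0,T)$, and initial datum $u(0,\cdot) = 0$, where the controls $v_-, v_+ \in L^2(0,T)$ are complex valued. Solutions are understood in the sense of transposition: $u \in L^2((0,T)\times(-L,L))$ is the solution, with state $u(T) = f \in L^2(-L,L)$ at time $T$, if for every complex valued $\varphi \in C^\infty([0,T]\times[-L,L])$ with $\varphi(t,\pm L) = 0$ for all $t \in [0,T]$, $$\int_0^T\!\!\int_{-L}^{L} u\,(\partial_t \varphi + \partial_{xx}\varphi)\,dx\,dt = \int_{-L}^{L} f(x)\,\varphi(T,x)\,dx + \int_0^T v_+(t)\,\partial_x\varphi(t,L)\,dt - \int_0^T v_-(t)\,\partial_x\varphi(t,-L)\,dt .$$ Let $\mathscr{R}_L(T) \subset L^2(-L,L)$ be the reachable set, i.e. the set of all states $u(T) \in L^2(-L,L)$ so obtained as $v_-, v_+$ range over $L^2(0,T)$. For $L_0 > 0$ let $\mathcal{S}(L_0) = \{x + iy \in \mathbb{C} : |x| +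 |y| < L_0\}$, and let $\mathscr{A}(L_0)$ be the set of complex valued functions in $L^2(-L,L)$ that can be extended analytically to $\mathcal{S}(L_0)$, i.e. that coincide almost everywhere on $(-L,L)$ with a function analytic in $\mathcal{S}(L_0)$. Then, for all $L > 0$ and $T > 0$, $$\bigcup_{L_0 > L} \mathscr{A}(L_0) \subset \mathscr{R}_L(T).$$ -/

import Mathlib

open MeasureTheory Set
open scoped ContDiff

noncomputable section

namespace HeatReach

/-- The Lebesgue measure on the space interval `(-L, L)`. -/
abbrev spaceMeasure (L : ℝ) : Measure ℝ := volume.restrict (Ioo (-L) L)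

/-- The Lebesgue measure on the time interval `(0, T)`. -/
abbrev timeMeasure (T : ℝ) : Measure ℝ := volume.restrict (Ioo 0 T)

/-- The Lebesgue measure on the space-time domain `(0, T) × (-L, L)`; points are pairs `(t, x)`. -/
abbrev cylinderMeasure (L T : ℝ) : Measure (ℝ × ℝ) :=
  volume.restrict (Ioo 0 T ×ˢ Ioo (-L) L)

/-- The space `L²(-L, L)` of complex valued functions. -/
abbrev StateSpace (L : ℝ) : Type := Lp ℂ 2 (spaceMeasure L)

/-- The space `L²(0, T)` of complex valued controls. -/
abbrev ControlSpace (T : ℝ) : Type := Lp ℂ 2 (timeMeasure T)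

/-- The space `L²((0, T) × (-L, L))` of complex valued functions of `(t, x)`. -/
abbrev TrajectorySpace (L T : ℝ) : Type := Lp ℂ 2 (cylinderMeasure L T)

/-- The open square `{x + i y : |x| + |y| < L₀}`. -/
def square (L₀ : ℝ) : Set ℂ := {z | |z.re| + |z.im| < L₀}

/-- The functions `f ∈ L²(-L, L)` that can be extended analytically to the square of parameter `L₀`,
i.e. that coincide almost everywhere in `(-L, L)` with a function analytic in this square. -/
def analyticStates (L L₀ : ℝ) : Set (StateSpace L) :=
  {f | ∃ F : ℂ → ℂ, AnalyticOnNhd ℂ F (square L₀) ∧ ∀ᵐ x ∂(spaceMeasure L), f x = F (x : ℂ)}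

/-- Test functions on `[0, T] × [-L, L]`: restrictions of smooth functions of `(t, x)`, vanishing on
the lateral boundary `x = ± L`, with no condition at the times `0` and `T`. -/
structure IsTestFunction (L T : ℝ) (φ : ℝ → ℝ → ℂ) : Prop where
  smooth : ContDiff ℝ ∞ (fun p : ℝ × ℝ => φ p.1 p.2)
  left : ∀ t ∈ Icc 0 T, φ t (-L) = 0
  right : ∀ t ∈ Icc 0 T, φ t L = 0

/-- `u` solves, in the sense of transposition, the heat equation
`∂ₜ u - ∂ₓₓ u = 0` in `(0, T) × (-L, L)`, `u(t, -L) = vm(t)`, `u(t, L) = vp(t)`, `u(0, ·) = 0`,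
and its state at time `T` is `f`. The identity is the one obtained by multiplying the equation by a
test function and integrating by parts, so that the initial, boundary and final values of `u` enter
through the boundary terms (the term `∫ u(0, x) φ(0, x) dx` is zero). Given `vm` and `vp`,
it determines both `u` and `f`. -/
def IsSolutionWithFinalState (L T : ℝ) (vm vp : ControlSpace T) (u : TrajectorySpace L T)
    (f : StateSpace L) : Prop :=
  ∀ φ : ℝ → ℝ → ℂ, IsTestFunction L T φ →
    ∫ p, u p * (deriv (fun t => φ t p.2) p.1 + iteratedDeriv 2 (φ p.1) p.2) ∂(cylinderMeasure L T)
      = (∫ x, f x * φ T x ∂(spaceMeasure L))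
        + (∫ t, vp t * deriv (φ t) L ∂(timeMeasure T))
        - ∫ t, vm t * deriv (φ t) (-L) ∂(timeMeasure T)

/-- The reachable set at time `T`: the states `u(T) ∈ L²(-L, L)` of the solutions of the heat
equation with zero initial datum and Dirichlet controls in `L²(0, T)` at both ends. -/
def reachableSet (L T : ℝ) : Set (StateSpace L) :=
  {f | ∃ (vm vp : ControlSpace T) (u : TrajectorySpace L T),
    IsSolutionWithFinalState L T vm vp u f}

end HeatReach

end

/-
Cauchy's formula on a square slightly larger than `square L` splits the analytic extension `F` into
Cauchy integrals over the four sides. On each side `1 / (ζ - x) = σ ∫₀^∞ e^{-rσ(ζ - x)} dr` for some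
`σ` with `Re σ² > 0`, so `F` is a superposition of exponentials `e^{λx}` with `λ²` in a sector of
the open right half plane. Replacing `e^{λx}` by `e^{λx + λ²(t - T)}` gives a solution of the heat
equation for `t ≤ T` whose final state is `F`, but whose initial state need not vanish.

Before time `T` this solution is `∑ cₙ(t) xⁿ / n!`, where `cₙ' = cₙ₊₂` and `c₀`, `c₁` are Gevrey of
order 1 in time. Truncating `c₀`, `c₁` by a Gevrey cutoff of order 2 that is `1` near time `0` and
`0` near time `T` produces another solution, with the same initial state and zero final state: the
series still converges because `n!²` is at most `(2n)!`. Subtract it.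
-/

open Filter Topology

namespace HeatReach

section Integration

lemma memLp_restrict_of_continuousOn {X E : Type*} [TopologicalSpace X] [MeasurableSpace X]
    [OpensMeasurableSpace X] [SecondCountableTopology X] {μ : Measure X}
    [IsFiniteMeasureOnCompacts μ] [NormedAddCommGroup E] {s K : Set X} (hK : IsCompact K)
    (hs : MeasurableSet s) (hsK : s ⊆ K) {g : X → E} (hg : ContinuousOn g K) (p : ENNReal) :
    MemLp g p (μ.restrict s) := by
  obtain ⟨C, hC⟩ := hK.exists_bound_of_continuousOn hg
  have : IsFiniteMeasure (μ.restrict s) :=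
    ⟨by simpa using (measure_mono hsK).trans_lt hK.measure_lt_top⟩
  refine MemLp.of_bound ((hg.mono hsK).aestronglyMeasurable hs) C ?_
  filter_upwards [ae_restrict_mem hs] with x hx using hC x (hsK hx)

lemma integral_mul_congr_left {X 𝕜 : Type*} [MeasurableSpace X] {μ : Measure X} [RCLike 𝕜]
    {f g h : X → 𝕜} (hfg : f =ᵐ[μ] g) : ∫ x, f x * h x ∂μ = ∫ x, g x * h x ∂μ :=
  integral_congr_ae (hfg.mul .rfl)

variable {E : Type*} [NormedAddCommGroup E] {a b c d : ℝ}

lemma integrableOn_Ioo_prod_of_continuousOn {g : ℝ × ℝ → E}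
    (hg : ContinuousOn g (Icc a b ×ˢ Icc c d)) : IntegrableOn g (Ioo a b ×ˢ Ioo c d) :=
  (hg.integrableOn_compact (isCompact_Icc.prod isCompact_Icc)).mono_set
    (prod_mono Ioo_subset_Icc_self Ioo_subset_Icc_self)

lemma continuousOn_slice_fst {g : ℝ → ℝ → E}
    (hg : ContinuousOn (fun p : ℝ × ℝ => g p.1 p.2) (Icc a b ×ˢ Icc c d)) {x : ℝ}
    (hx : x ∈ Icc c d) : ContinuousOn (fun t => g t x) (Icc a b) :=
  hg.comp (f := fun t => (t, x)) (by fun_prop) fun _ ht => ⟨ht, hx⟩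

variable [NormedSpace ℝ E] [CompleteSpace E]

lemma setIntegral_Ioo_eq_sub_of_hasDerivAt (hab : a ≤ b) {g g' : ℝ → E}
    (hg : ContinuousOn g (Icc a b)) (hg' : ContinuousOn g' (Icc a b))
    (h : ∀ x ∈ Ioo a b, HasDerivAt g (g' x) x) :
    ∫ x in Ioo a b, g' x = g b - g a := by
  rw [← integral_Ioc_eq_integral_Ioo, ← intervalIntegral.integral_of_le hab]
  exact intervalIntegral.integral_eq_sub_of_hasDerivAt_of_le hab hg h
    (hg'.intervalIntegrable_of_Icc hab)

lemma setIntegral_Ioo_prod_of_hasDerivAt_fst (hab : a ≤ b) {g g' : ℝ → ℝ → E}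
    (hg : ContinuousOn (fun p : ℝ × ℝ => g p.1 p.2) (Icc a b ×ˢ Icc c d))
    (hg' : ContinuousOn (fun p : ℝ × ℝ => g' p.1 p.2) (Icc a b ×ˢ Icc c d))
    (h : ∀ t ∈ Ioo a b, ∀ x ∈ Ioo c d, HasDerivAt (fun t => g t x) (g' t x) t) :
    ∫ p in Ioo a b ×ˢ Ioo c d, g' p.1 p.2 = ∫ x in Ioo c d, (g b x - g a x) := by
  have hint : Integrable _ _ := integrableOn_Ioo_prod_of_continuousOn hg'
  rw [Measure.volume_eq_prod] at hint ⊢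
  rw [← Measure.prod_restrict] at hint ⊢
  rw [integral_prod_symm _ hint]
  refine setIntegral_congr_fun measurableSet_Ioo fun x hx => ?_
  have hx' := Ioo_subset_Icc_self hx
  exact setIntegral_Ioo_eq_sub_of_hasDerivAt hab (continuousOn_slice_fst hg hx')
    (continuousOn_slice_fst hg' hx') fun t ht => h t ht x hx

lemma setIntegral_Ioo_prod_of_hasDerivAt_snd (hcd : c ≤ d) {g g' : ℝ → ℝ → E}
    (hg : ContinuousOn (fun p : ℝ × ℝ => g p.1 p.2) (Icc a b ×ˢ Icc c d))
    (hg' : ContinuousOn (fun p : ℝ × ℝ => g' p.1 p.2) (Icc a b ×ˢ Icc c d))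
    (h : ∀ t ∈ Ioo a b, ∀ x ∈ Ioo c d, HasDerivAt (g t) (g' t x) x) :
    ∫ p in Ioo a b ×ˢ Ioo c d, g' p.1 p.2 = ∫ t in Ioo a b, (g t d - g t c) := by
  have hswap {k : ℝ → ℝ → E}
      (hk : ContinuousOn (fun p : ℝ × ℝ => k p.1 p.2) (Icc a b ×ˢ Icc c d)) :
      ContinuousOn (fun p : ℝ × ℝ => k p.2 p.1) (Icc c d ×ˢ Icc a b) :=
    hk.comp continuous_swap.continuousOn fun p hp => ⟨hp.2, hp.1⟩
  rw [← setIntegral_Ioo_prod_of_hasDerivAt_fst hcd (hswap hg) (hswap hg')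
    fun x hx t ht => h t ht x hx, Measure.volume_eq_prod,
    ← setIntegral_prod_swap _ _ fun p => g' p.1 p.2]
  rfl

end Integration

section PartialDerivatives

variable {E : Type*} [NormedAddCommGroup E] [NormedSpace ℝ E] {φ : ℝ → ℝ → E}

lemma hasDerivAt_fst_of_contDiff (hφ : ContDiff ℝ ∞ fun p : ℝ × ℝ => φ p.1 p.2) (t x : ℝ) :
    HasDerivAt (fun t => φ t x) (deriv (fun t => φ t x) t) t :=
  ((hφ.comp (f := fun t => (t, x)) (by fun_prop)).differentiable (by simp) t).hasDerivAt

lemma hasDerivAt_snd_of_contDiff (hφ : ContDiff ℝ ∞ fun p : ℝ × ℝ => φ p.1 p.2) (t x : ℝ) :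
    HasDerivAt (φ t) (deriv (φ t) x) x :=
  ((hφ.comp (f := fun x => (t, x)) (by fun_prop)).differentiable (by simp) x).hasDerivAt

lemma contDiff_deriv_fst (hφ : ContDiff ℝ ∞ fun p : ℝ × ℝ => φ p.1 p.2) :
    ContDiff ℝ ∞ fun p : ℝ × ℝ => deriv (fun t => φ t p.2) p.1 :=
  ContDiff.fderiv_apply (f := fun (p : ℝ × ℝ) t => φ t p.2) (n := ∞)
    (hφ.comp (f := fun q : (ℝ × ℝ) × ℝ => (q.2, q.1.2)) (by fun_prop)) contDiff_fst
    contDiff_const (by simp)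

lemma contDiff_deriv_snd (hφ : ContDiff ℝ ∞ fun p : ℝ × ℝ => φ p.1 p.2) :
    ContDiff ℝ ∞ fun p : ℝ × ℝ => deriv (φ p.1) p.2 :=
  ContDiff.fderiv_apply (f := fun (p : ℝ × ℝ) x => φ p.1 x) (n := ∞)
    (hφ.comp (f := fun q : (ℝ × ℝ) × ℝ => (q.1.1, q.2)) (by fun_prop)) contDiff_snd
    contDiff_const (by simp)

end PartialDerivatives

/-- `u` is a classical solution of the heat equation `∂ₜ u = ∂ₓₓ u` in `(0, T) × (-L, L)`, with
space derivatives `ux` and `uxx`, all three functions being continuous up to the boundary. -/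
structure IsClassicalSolution (L T : ℝ) (u ux uxx : ℝ → ℝ → ℂ) : Prop where
  continuousOn : ContinuousOn (fun p : ℝ × ℝ => u p.1 p.2) (Icc 0 T ×ˢ Icc (-L) L)
  continuousOn_dx : ContinuousOn (fun p : ℝ × ℝ => ux p.1 p.2) (Icc 0 T ×ˢ Icc (-L) L)
  continuousOn_dxx : ContinuousOn (fun p : ℝ × ℝ => uxx p.1 p.2) (Icc 0 T ×ˢ Icc (-L) L)
  hasDerivAt_dx : ∀ t ∈ Ioo 0 T, ∀ x ∈ Ioo (-L) L, HasDerivAt (u t) (ux t x) x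
  hasDerivAt_dxx : ∀ t ∈ Ioo 0 T, ∀ x ∈ Ioo (-L) L, HasDerivAt (ux t) (uxx t x) x
  hasDerivAt_dt : ∀ t ∈ Ioo 0 T, ∀ x ∈ Ioo (-L) L, HasDerivAt (fun t => u t x) (uxx t x) t

namespace IsClassicalSolution

variable {L T : ℝ} {u ux uxx v vx vxx : ℝ → ℝ → ℂ}

lemma zero (L T : ℝ) : IsClassicalSolution L T 0 0 0 where
  continuousOn := continuousOn_const
  continuousOn_dx := continuousOn_const
  continuousOn_dxx := continuousOn_const
  hasDerivAt_dx _ _ x _ := hasDerivAt_const x 0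
  hasDerivAt_dxx _ _ x _ := hasDerivAt_const x 0
  hasDerivAt_dt t _ _ _ := hasDerivAt_const t 0

lemma add (hu : IsClassicalSolution L T u ux uxx) (hv : IsClassicalSolution L T v vx vxx) :
    IsClassicalSolution L T (u + v) (ux + vx) (uxx + vxx) where
  continuousOn := hu.continuousOn.add hv.continuousOn
  continuousOn_dx := hu.continuousOn_dx.add hv.continuousOn_dx
  continuousOn_dxx := hu.continuousOn_dxx.add hv.continuousOn_dxx
  hasDerivAt_dx t ht x hx := (hu.hasDerivAt_dx t ht x hx).add (hv.hasDerivAt_dx t ht x hx)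
  hasDerivAt_dxx t ht x hx := (hu.hasDerivAt_dxx t ht x hx).add (hv.hasDerivAt_dxx t ht x hx)
  hasDerivAt_dt t ht x hx := (hu.hasDerivAt_dt t ht x hx).add (hv.hasDerivAt_dt t ht x hx)

lemma const_smul (a : ℂ) (hu : IsClassicalSolution L T u ux uxx) :
    IsClassicalSolution L T (a • u) (a • ux) (a • uxx) where
  continuousOn := hu.continuousOn.const_smul a
  continuousOn_dx := hu.continuousOn_dx.const_smul a
  continuousOn_dxx := hu.continuousOn_dxx.const_smul a
  hasDerivAt_dx t ht x hx := (hu.hasDerivAt_dx t ht x hx).const_smul a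
  hasDerivAt_dxx t ht x hx := (hu.hasDerivAt_dxx t ht x hx).const_smul a
  hasDerivAt_dt t ht x hx := (hu.hasDerivAt_dt t ht x hx).const_smul a

variable {φ : ℝ → ℝ → ℂ}

lemma setIntegral_deriv_time_mul (hT : 0 ≤ T) (hu : IsClassicalSolution L T u ux uxx)
    (h0 : ∀ x ∈ Ioo (-L) L, u 0 x = 0) (hφ : IsTestFunction L T φ) :
    ∫ p in Ioo 0 T ×ˢ Ioo (-L) L,
        (uxx p.1 p.2 * φ p.1 p.2 + u p.1 p.2 * deriv (fun t => φ t p.2) p.1)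
      = ∫ x in Ioo (-L) L, u T x * φ T x := by
  have hφc := hφ.smooth.continuous.continuousOn (s := Icc 0 T ×ˢ Icc (-L) L)
  have hφt := (contDiff_deriv_fst hφ.smooth).continuous.continuousOn (s := Icc 0 T ×ˢ Icc (-L) L)
  rw [setIntegral_Ioo_prod_of_hasDerivAt_fst hT (g := fun t x => u t x * φ t x)
    (g' := fun t x => uxx t x * φ t x + u t x * deriv (fun t => φ t x) t)
    (hu.continuousOn.mul hφc) ((hu.continuousOn_dxx.mul hφc).add (hu.continuousOn.mul hφt))
    fun t ht x hx => (hu.hasDerivAt_dt t ht x hx).mul (hasDerivAt_fst_of_contDiff hφ.smooth t x)]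
  exact setIntegral_congr_fun measurableSet_Ioo fun x hx => by simp [h0 x hx]

lemma setIntegral_deriv_space_mul (hL : 0 ≤ L) (hu : IsClassicalSolution L T u ux uxx)
    (hφ : IsTestFunction L T φ) :
    ∫ p in Ioo 0 T ×ˢ Ioo (-L) L,
        (u p.1 p.2 * iteratedDeriv 2 (φ p.1) p.2 - uxx p.1 p.2 * φ p.1 p.2)
      = ∫ t in Ioo 0 T, (u t L * deriv (φ t) L - u t (-L) * deriv (φ t) (-L)) := by
  have hφx := contDiff_deriv_snd hφ.smooth
  have hφc := hφ.smooth.continuous.continuousOn (s := Icc 0 T ×ˢ Icc (-L) L)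
  have hφxc := hφx.continuous.continuousOn (s := Icc 0 T ×ˢ Icc (-L) L)
  have hφxxc := (contDiff_deriv_snd (φ := fun t => deriv (φ t)) hφx).continuous.continuousOn
    (s := Icc 0 T ×ˢ Icc (-L) L)
  simp only [iteratedDeriv_succ, iteratedDeriv_zero]
  rw [setIntegral_Ioo_prod_of_hasDerivAt_snd (neg_le_self hL)
    (g := fun t x => u t x * deriv (φ t) x - ux t x * φ t x)
    (g' := fun t x => u t x * deriv (deriv (φ t)) x - uxx t x * φ t x)
    ((hu.continuousOn.mul hφxc).sub (hu.continuousOn_dx.mul hφc))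
    ((hu.continuousOn.mul hφxxc).sub (hu.continuousOn_dxx.mul hφc))]
  · refine setIntegral_congr_fun measurableSet_Ioo fun t ht => ?_
    simp [hφ.left t (Ioo_subset_Icc_self ht), hφ.right t (Ioo_subset_Icc_self ht)]
  · intro t ht x hx
    refine (((hu.hasDerivAt_dx t ht x hx).mul
        (hasDerivAt_snd_of_contDiff (φ := fun t => deriv (φ t)) hφx t x)).sub
      ((hu.hasDerivAt_dxx t ht x hx).mul
        (hasDerivAt_snd_of_contDiff hφ.smooth t x))).congr_deriv ?_
    ring

lemma green_identity (hL : 0 ≤ L) (hT : 0 ≤ T) (hu : IsClassicalSolution L T u ux uxx)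
    (h0 : ∀ x ∈ Ioo (-L) L, u 0 x = 0) (hφ : IsTestFunction L T φ) :
    ∫ p, u p.1 p.2 * (deriv (fun t => φ t p.2) p.1 + iteratedDeriv 2 (φ p.1) p.2)
        ∂(cylinderMeasure L T)
      = (∫ x, u T x * φ T x ∂(spaceMeasure L))
        + (∫ t, u t L * deriv (φ t) L ∂(timeMeasure T))
        - ∫ t, u t (-L) * deriv (φ t) (-L) ∂(timeMeasure T) := by
  have hφc := hφ.smooth.continuous.continuousOn (s := Icc 0 T ×ˢ Icc (-L) L)
  have hφx := contDiff_deriv_snd hφ.smooth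
  have hφt := (contDiff_deriv_fst hφ.smooth).continuous.continuousOn (s := Icc 0 T ×ˢ Icc (-L) L)
  have hφxx := (contDiff_deriv_snd (φ := fun t => deriv (φ t)) hφx).continuous.continuousOn
    (s := Icc 0 T ×ˢ Icc (-L) L)
  have hboundary {x : ℝ} (hx : x ∈ Icc (-L) L) :
      IntegrableOn (fun t => u t x * deriv (φ t) x) (Ioo 0 T) :=
    ((continuousOn_slice_fst (g := fun t x => u t x * deriv (φ t) x)
      (hu.continuousOn.mul hφx.continuous.continuousOn) hx).integrableOn_Icc).mono_set
      Ioo_subset_Icc_self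
  have hspace := hu.setIntegral_deriv_space_mul hL hφ
  rw [integral_sub (hboundary (right_mem_Icc.2 (neg_le_self hL)))
    (hboundary (left_mem_Icc.2 (neg_le_self hL)))] at hspace
  rw [add_sub_assoc, ← hspace, ← hu.setIntegral_deriv_time_mul hT h0 hφ, ← integral_add]
  · exact integral_congr_ae (.of_forall fun p => by ring)
  · exact integrableOn_Ioo_prod_of_continuousOn
      ((hu.continuousOn_dxx.mul hφc).add (hu.continuousOn.mul hφt))
  · simp only [iteratedDeriv_succ, iteratedDeriv_zero]
    exact integrableOn_Ioo_prod_of_continuousOn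
      ((hu.continuousOn.mul hφxx).sub (hu.continuousOn_dxx.mul hφc))

end IsClassicalSolution

/-- The functions that coincide on `(-L, L)` with the state at time `T` of a classical solution
vanishing at time `0`. -/
def classicallyReachable (L T : ℝ) : Submodule ℂ (ℝ → ℂ) where
  carrier := {F | ∃ u ux uxx, IsClassicalSolution L T u ux uxx ∧
    (∀ x ∈ Ioo (-L) L, u 0 x = 0) ∧ ∀ x ∈ Ioo (-L) L, u T x = F x}
  zero_mem' := ⟨0, 0, 0, .zero L T, fun _ _ => rfl, fun _ _ => rfl⟩
  add_mem' := by
    rintro F G ⟨u, ux, uxx, hu, hu0, huT⟩ ⟨v, vx, vxx, hv, hv0, hvT⟩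
    exact ⟨_, _, _, hu.add hv, fun x hx => by simp [hu0 x hx, hv0 x hx],
      fun x hx => by simp [huT x hx, hvT x hx]⟩
  smul_mem' := by
    rintro a F ⟨u, ux, uxx, hu, hu0, huT⟩
    exact ⟨_, _, _, hu.const_smul a, fun x hx => by simp [hu0 x hx],
      fun x hx => by simp [huT x hx]⟩

lemma classicallyReachable_congr {L T : ℝ} {F G : ℝ → ℂ} (h : EqOn F G (Ioo (-L) L)) :
    F ∈ classicallyReachable L T ↔ G ∈ classicallyReachable L T := by
  have himp {F G : ℝ → ℂ} (h : EqOn F G (Ioo (-L) L)) (hF : F ∈ classicallyReachable L T) :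
      G ∈ classicallyReachable L T := by
    obtain ⟨u, ux, uxx, hu, hu0, huT⟩ := hF
    exact ⟨u, ux, uxx, hu, hu0, fun x hx => (huT x hx).trans (h hx)⟩
  exact ⟨himp h, himp h.symm⟩

lemma mem_reachableSet_of_mem_classicallyReachable {L T : ℝ} (hL : 0 ≤ L) (hT : 0 ≤ T)
    {F : ℝ → ℂ} (hF : F ∈ classicallyReachable L T) {f : StateSpace L}
    (hf : f =ᵐ[spaceMeasure L] F) : f ∈ reachableSet L T := by
  obtain ⟨u, ux, uxx, hu, hu0, huT⟩ := hF
  have hmem : MemLp (fun p : ℝ × ℝ => u p.1 p.2) 2 (cylinderMeasure L T) :=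
    memLp_restrict_of_continuousOn (isCompact_Icc.prod isCompact_Icc)
      (measurableSet_Ioo.prod measurableSet_Ioo)
      (prod_mono Ioo_subset_Icc_self Ioo_subset_Icc_self) hu.continuousOn 2
  have htrace {x : ℝ} (hx : x ∈ Icc (-L) L) : MemLp (fun t => u t x) 2 (timeMeasure T) :=
    memLp_restrict_of_continuousOn isCompact_Icc measurableSet_Ioo Ioo_subset_Icc_self
      (continuousOn_slice_fst hu.continuousOn hx) 2
  have hleft := htrace (left_mem_Icc.2 (neg_le_self hL))
  have hright := htrace (right_mem_Icc.2 (neg_le_self hL))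
  have hfu : f =ᵐ[spaceMeasure L] u T := by
    filter_upwards [hf, ae_restrict_mem measurableSet_Ioo] with x hx hxm
    rw [hx, huT x hxm]
  refine ⟨hleft.toLp _, hright.toLp _, hmem.toLp _, fun φ hφ => ?_⟩
  rw [integral_mul_congr_left hmem.coeFn_toLp, integral_mul_congr_left hfu,
    integral_mul_congr_left hright.coeFn_toLp, integral_mul_congr_left hleft.coeFn_toLp]
  exact hu.green_identity hL hT hu0 hφ

section Gevrey

open scoped Nat

/-- The Gevrey bounds of order `s` on all derivatives of `f` at the single point `t`, with explicit
constants `C` and `ε`: the smallness of `ε` decides the convergence of the series built on `f`. -/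
structure IsGevreyAt {E : Type*} [NormedAddCommGroup E] [NormedSpace ℝ E] (s : ℕ) (C ε : ℝ)
    (f : ℝ → E) (t : ℝ) : Prop where
  contDiffAt : ContDiffAt ℝ ∞ f t
  norm_iteratedDeriv_le : ∀ n, ‖iteratedDeriv n f t‖ ≤ C * ε ^ n * (n ! : ℝ) ^ s

namespace IsGevreyAt

variable {E : Type*} [NormedAddCommGroup E] [NormedSpace ℝ E] {s : ℕ} {C C₀ C' ε ε' t : ℝ}
  {f g : ℝ → E}

lemma norm_le (hf : IsGevreyAt s C ε f t) : ‖f t‖ ≤ C := by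
  simpa using hf.norm_iteratedDeriv_le 0

lemma congr (hf : IsGevreyAt s C ε f t) (hfg : f =ᶠ[𝓝 t] g) : IsGevreyAt s C ε g t where
  contDiffAt := hf.contDiffAt.congr_of_eventuallyEq hfg.symm
  norm_iteratedDeriv_le n := by
    rw [← hfg.iteratedDeriv_eq n]
    exact hf.norm_iteratedDeriv_le n

lemma const_zero (hC : 0 ≤ C) (hε : 0 ≤ ε) : IsGevreyAt s C ε (fun _ => (0 : E)) t where
  contDiffAt := contDiffAt_const
  norm_iteratedDeriv_le n := by
    rw [iteratedDeriv_const, ite_self, norm_zero]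
    positivity

lemma comp_sub_const {a : ℝ} (hf : IsGevreyAt s C ε f (t - a)) :
    IsGevreyAt s C ε (fun t => f (t - a)) t where
  contDiffAt := hf.contDiffAt.comp t (by fun_prop)
  norm_iteratedDeriv_le n := by
    simpa only [iteratedDeriv_comp_sub_const] using hf.norm_iteratedDeriv_le n

lemma comp_const_sub {a : ℝ} (hf : IsGevreyAt s C ε f (a - t)) :
    IsGevreyAt s C ε (fun t => f (a - t)) t where
  contDiffAt := hf.contDiffAt.comp t (by fun_prop)
  norm_iteratedDeriv_le n := by
    simpa [iteratedDeriv_comp_const_sub, norm_smul] using hf.norm_iteratedDeriv_le n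

lemma const_smul {𝕜 : Type*} [NormedField 𝕜] [NormedSpace 𝕜 E] [SMulCommClass ℝ 𝕜 E]
    (a : 𝕜) (hf : IsGevreyAt s C ε f t) : IsGevreyAt s (‖a‖ * C) ε (a • f) t where
  contDiffAt := hf.contDiffAt.const_smul a
  norm_iteratedDeriv_le n := by
    rw [iteratedDeriv_const_smul_field, norm_smul, mul_assoc, mul_assoc, ← mul_assoc C]
    gcongr
    exact hf.norm_iteratedDeriv_le n

lemma of_deriv (hε : 0 < ε) (hf : ContDiffAt ℝ ∞ f t) (hC₀ : ‖f t‖ ≤ C₀)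
    (hf' : IsGevreyAt s C ε (deriv f) t) : IsGevreyAt s (C₀ + C / ε) ε f t where
  contDiffAt := hf
  norm_iteratedDeriv_le n := by
    have hC : 0 ≤ C := (norm_nonneg _).trans hf'.norm_le
    have hC₀' : 0 ≤ C₀ := (norm_nonneg _).trans hC₀
    have hCε : 0 ≤ C / ε := by positivity
    rcases n with _ | n
    · simpa using hC₀.trans (le_add_of_nonneg_right hCε)
    calc ‖iteratedDeriv (n + 1) f t‖ ≤ C * ε ^ n * (n ! : ℝ) ^ s := by
          rw [iteratedDeriv_succ']
          exact hf'.norm_iteratedDeriv_le n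
      _ = C / ε * ε ^ (n + 1) * (n ! : ℝ) ^ s := by rw [pow_succ']; field_simp
      _ ≤ (C₀ + C / ε) * ε ^ (n + 1) * ((n + 1)! : ℝ) ^ s := by
        gcongr
        · exact le_add_of_nonneg_left hC₀'
        · exact n.le_succ

lemma succ_order (hε : 0 < ε) (hε' : 0 ≤ ε') (hf : IsGevreyAt s C ε' f t) :
    IsGevreyAt (s + 1) (C * Real.exp (ε' / ε)) ε f t where
  contDiffAt := hf.contDiffAt
  norm_iteratedDeriv_le n := by
    have hC : 0 ≤ C := (norm_nonneg _).trans hf.norm_le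
    have hpow : ε' ^ n ≤ Real.exp (ε' / ε) * ε ^ n * n ! := by
      have hexp := Real.pow_div_factorial_le_exp _ (div_nonneg hε' hε.le) n
      rwa [div_pow, div_div, div_le_iff₀ (by positivity), ← mul_assoc] at hexp
    calc ‖iteratedDeriv n f t‖ ≤ C * ε' ^ n * (n ! : ℝ) ^ s := hf.norm_iteratedDeriv_le n
      _ ≤ C * (Real.exp (ε' / ε) * ε ^ n * n !) * (n ! : ℝ) ^ s := by gcongr
      _ = C * Real.exp (ε' / ε) * ε ^ n * (n ! : ℝ) ^ (s + 1) := by ring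

lemma mul {𝔸 : Type*} [NormedRing 𝔸] [NormedAlgebra ℝ 𝔸] {f g : ℝ → 𝔸} (hε : 0 ≤ ε)
    (hε' : 0 ≤ ε') (hf : IsGevreyAt s C ε f t) (hg : IsGevreyAt s C' ε' g t) :
    IsGevreyAt s (C * C') (ε + ε') (f * g) t where
  contDiffAt := hf.contDiffAt.mul hg.contDiffAt
  norm_iteratedDeriv_le n := by
    have hC : 0 ≤ C := (norm_nonneg _).trans hf.norm_le
    have hC' : 0 ≤ C' := (norm_nonneg _).trans hg.norm_le
    rw [iteratedDeriv_mul (hf.contDiffAt.of_le (by exact_mod_cast le_top))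
      (hg.contDiffAt.of_le (by exact_mod_cast le_top)), add_pow, Finset.mul_sum, Finset.sum_mul]
    refine norm_sum_le_of_le _ fun i hi => ?_
    have hfac : (i ! * (n - i)! : ℝ) ≤ n ! := mod_cast Nat.le_of_dvd n.factorial_pos
      (Nat.factorial_mul_factorial_dvd_factorial (Finset.mem_range_succ_iff.1 hi))
    rw [mul_assoc, ← nsmul_eq_mul]
    calc ‖n.choose i • (iteratedDeriv i f t * iteratedDeriv (n - i) g t)‖
        ≤ n.choose i * (‖iteratedDeriv i f t‖ * ‖iteratedDeriv (n - i) g t‖) := by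
          refine (norm_nsmul_le).trans ?_
          gcongr
          exact norm_mul_le _ _
      _ ≤ n.choose i * ((C * ε ^ i * (i ! : ℝ) ^ s) *
            (C' * ε' ^ (n - i) * ((n - i)! : ℝ) ^ s)) := by
          gcongr
          exacts [hf.norm_iteratedDeriv_le i, hg.norm_iteratedDeriv_le (n - i)]
      _ = C * C' * (ε ^ i * ε' ^ (n - i) * n.choose i) * (i ! * (n - i)! : ℝ) ^ s := by
          rw [mul_pow]
          ring
      _ ≤ C * C' * (ε ^ i * ε' ^ (n - i) * n.choose i) * (n ! : ℝ) ^ s := by gcongr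

end IsGevreyAt

lemma iteratedDeriv_comp_ofReal {E : Type*} [NormedAddCommGroup E] [NormedSpace ℂ E]
    [CompleteSpace E] {f : ℂ → E} (n : ℕ) {t : ℝ} (hf : AnalyticAt ℂ f t) :
    iteratedDeriv n (fun s : ℝ => f s) t = iteratedDeriv n f t := by
  induction n generalizing t with
  | zero => rfl
  | succ n ih =>
    have hev : iteratedDeriv n (fun s : ℝ => f s) =ᶠ[𝓝 t] fun s : ℝ => iteratedDeriv n f s :=
      (Complex.continuous_ofReal.continuousAt.eventually hf.eventually_analyticAt).mono
        fun s hs => ih hs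
    rw [iteratedDeriv_succ, iteratedDeriv_succ, hev.deriv_eq]
    have hd : DifferentiableAt ℂ (iteratedDeriv n f) t := by
      rw [iteratedDeriv_eq_iterate]
      exact (hf.iterated_deriv n).differentiableAt
    exact (hd.hasDerivAt.scomp t Complex.ofRealCLM.hasDerivAt).deriv.trans (one_smul _ _)

lemma ne_zero_and_le_re_inv_of_norm_sub_le {t : ℝ} (ht : 0 < t) {z : ℂ} (hz : ‖z - t‖ ≤ t / 2) :
    z ≠ 0 ∧ 2 / (9 * t) ≤ z⁻¹.re := by
  have hre : t / 2 ≤ z.re := by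
    have := (Complex.abs_re_le_norm (z - t)).trans hz
    rw [Complex.sub_re, Complex.ofReal_re] at this
    linarith [(abs_le.1 this).1]
  have hnorm : ‖z‖ ≤ 3 / 2 * t := by
    have := norm_le_norm_sub_add z t
    rw [Complex.norm_of_nonneg ht.le] at this
    linarith
  have hz0 : z ≠ 0 := by
    rintro rfl
    rw [Complex.zero_re] at hre
    linarith
  have hsq : Complex.normSq z ≤ (3 / 2 * t) ^ 2 := by
    rw [Complex.normSq_eq_norm_sq]
    gcongr
  refine ⟨hz0, ?_⟩
  rw [Complex.inv_re, div_le_div_iff₀ (by positivity) (Complex.normSq_pos.2 hz0)]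
  nlinarith

-- Cauchy's estimate on the disc of centre `t` and radius `t / 2`, where `z ↦ exp (-M / z)` is at
-- most `exp (-2 M / (9 t))`.
lemma norm_iteratedDeriv_exp_neg_inv_le {M t : ℝ} (hM : 0 < M) (ht : 0 < t) (n : ℕ) :
    ‖iteratedDeriv n (fun z : ℂ => Complex.exp (-(M * z⁻¹))) t‖ ≤ (9 / M) ^ n * (n ! : ℝ) ^ 2 := by
  have hbound (z : ℂ) (hz : ‖z - t‖ ≤ t / 2) :
      ‖Complex.exp (-(M * z⁻¹))‖ ≤ Real.exp (-(M * (2 / (9 * t)))) := by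
    rw [Complex.norm_exp, Complex.neg_re, Complex.re_ofReal_mul]
    gcongr
    exact (ne_zero_and_le_re_inv_of_norm_sub_le ht hz).2
  have hdiff : DiffContOnCl ℂ (fun z : ℂ => Complex.exp (-(M * z⁻¹))) (Metric.ball t (t / 2)) := by
    refine DifferentiableOn.diffContOnCl fun z hz => ?_
    have hz0 := (ne_zero_and_le_re_inv_of_norm_sub_le ht
      (mem_closedBall_iff_norm.1 (Metric.closure_ball_subset_closedBall hz))).1
    exact DifferentiableAt.differentiableWithinAt (by fun_prop (disch := assumption))
  refine (Complex.norm_iteratedDeriv_le_of_forall_mem_sphere_norm_le n (half_pos ht) hdiff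
    fun z hz => hbound z (mem_sphere_iff_norm.1 hz).le).trans ?_
  have hX : 0 < M * (2 / (9 * t)) := by positivity
  have hexp : Real.exp (-(M * (2 / (9 * t)))) ≤ n ! / (M * (2 / (9 * t))) ^ n := by
    rw [Real.exp_neg, inv_le_comm₀ (Real.exp_pos _) (by positivity), inv_div]
    exact Real.pow_div_factorial_le_exp _ hX.le n
  calc n ! * Real.exp (-(M * (2 / (9 * t)))) / (t / 2) ^ n
      ≤ n ! * (n ! / (M * (2 / (9 * t))) ^ n) / (t / 2) ^ n := by gcongr
    _ = (n ! : ℝ) ^ 2 / (M * (2 / (9 * t)) * (t / 2)) ^ n := by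
        rw [mul_pow _ (t / 2), sq, mul_div_assoc', div_div]
    _ = (9 / M) ^ n * (n ! : ℝ) ^ 2 := by
        rw [show M * (2 / (9 * t)) * (t / 2) = (9 / M)⁻¹ by field_simp, inv_pow, div_inv_eq_mul,
          mul_comm]

lemma isGevreyAt_expNegInvGlue_div_of_pos {M t : ℝ} (hM : 0 < M) (ht : 0 < t) :
    IsGevreyAt 2 1 (9 / M) (fun s => (expNegInvGlue (s / M) : ℂ)) t := by
  have han : AnalyticAt ℂ (fun z : ℂ => Complex.exp (-(M * z⁻¹))) t := by
    have : (t : ℂ) ≠ 0 := mod_cast ht.ne'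
    fun_prop (disch := assumption)
  have hexp : IsGevreyAt 2 1 (9 / M) (fun s : ℝ => Complex.exp (-(M * (s : ℂ)⁻¹))) t :=
    { contDiffAt := (han.restrictScalars (𝕜 := ℝ)).contDiffAt.comp t
        Complex.ofRealCLM.contDiff.contDiffAt
      norm_iteratedDeriv_le n := by
        rw [iteratedDeriv_comp_ofReal n han, one_mul]
        exact norm_iteratedDeriv_exp_neg_inv_le hM ht n }
  refine hexp.congr ?_
  filter_upwards [eventually_gt_nhds ht] with s hs
  rw [expNegInvGlue, if_neg (not_le.2 (div_pos hs hM)), inv_div]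
  push_cast
  rw [div_eq_mul_inv]

lemma isGevreyAt_expNegInvGlue_div {M : ℝ} (hM : 0 < M) (t : ℝ) :
    IsGevreyAt 2 1 (9 / M) (fun s => (expNegInvGlue (s / M) : ℂ)) t := by
  have hsmooth : ContDiff ℝ ∞ fun s => (expNegInvGlue (s / M) : ℂ) :=
    Complex.ofRealCLM.contDiff.comp (expNegInvGlue.contDiff.comp (by fun_prop))
  refine ⟨hsmooth.contDiffAt, fun n => ?_⟩
  have hclosed : IsClosed {s | ‖iteratedDeriv n (fun s => (expNegInvGlue (s / M) : ℂ)) s‖ ≤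
      1 * (9 / M) ^ n * (n ! : ℝ) ^ 2} :=
    isClosed_le (hsmooth.continuous_iteratedDeriv n (mod_cast le_top)).norm continuous_const
  rcases lt_or_ge t 0 with ht | ht
  · refine ((IsGevreyAt.const_zero zero_le_one (by positivity)).congr ?_).norm_iteratedDeriv_le n
    filter_upwards [eventually_lt_nhds ht] with s hs
    rw [expNegInvGlue.zero_of_nonpos (div_nonpos_of_nonpos_of_nonneg hs.le hM.le),
      Complex.ofReal_zero]
  · refine closure_minimal (s := Ioi 0) (fun s hs => ?_) hclosed (by rwa [closure_Ioi])
    exact (isGevreyAt_expNegInvGlue_div_of_pos hM hs).norm_iteratedDeriv_le n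

lemma exists_isGevreyAt_bump (a b : ℝ) {ε : ℝ} (hε : 0 < ε) :
    ∃ β : ℝ → ℝ, (∀ t ∈ Ioo a b, 0 < β t) ∧ (∀ t ∉ Ioo a b, β t = 0) ∧
      ∀ t, IsGevreyAt 2 1 ε (fun s => (β s : ℂ)) t := by
  have hM : 0 < 18 / ε := by positivity
  have hε2 : 9 / (18 / ε) = ε / 2 := by field_simp; norm_num
  refine ⟨fun t => expNegInvGlue ((t - a) / (18 / ε)) * expNegInvGlue ((b - t) / (18 / ε)),
    fun t ht => mul_pos (expNegInvGlue.pos_of_pos (div_pos (sub_pos.2 ht.1) hM))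
      (expNegInvGlue.pos_of_pos (div_pos (sub_pos.2 ht.2) hM)), fun t ht => ?_, fun t => ?_⟩
  · rw [mul_eq_zero, expNegInvGlue.zero_iff_nonpos, expNegInvGlue.zero_iff_nonpos,
      div_le_iff₀ hM, div_le_iff₀ hM, zero_mul, sub_nonpos, sub_nonpos]
    exact or_iff_not_imp_left.2 fun h => not_lt.1 fun h' => ht ⟨not_le.1 h, h'⟩
  · have hglue := isGevreyAt_expNegInvGlue_div hM
    rw [hε2] at hglue
    have := ((hglue (t - a)).comp_sub_const).mul (half_pos hε).le (half_pos hε).le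
      ((hglue (b - t)).comp_const_sub)
    rw [one_mul, add_halves] at this
    exact this.congr (.of_forall fun s => by simp)

lemma exists_hasDerivAt_const_mul_of_bump {β : ℝ → ℝ} {a b : ℝ} (hab : a < b) (hβ : Continuous β)
    (hpos : ∀ t ∈ Ioo a b, 0 < β t) (hzero : ∀ t ∉ Ioo a b, β t = 0) :
    ∃ (χ : ℝ → ℝ) (r : ℝ), (∀ t ≤ a, χ t = 1) ∧ (∀ t, b ≤ t → χ t = 0) ∧
      ∀ t, HasDerivAt χ (r * β t) t := by
  have hint (c d : ℝ) : IntervalIntegrable β volume c d := hβ.intervalIntegrable c d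
  have hvanish {c d : ℝ} (h : ∀ s ∈ uIoc c d, s ∉ Ioo a b) : ∫ s in c..d, β s = 0 :=
    intervalIntegral.integral_zero_ae (.of_forall fun s hs => hzero s (h s hs))
  set I : ℝ := ∫ s in a..b, β s with hI
  have hIpos : 0 < I := intervalIntegral.intervalIntegral_pos_of_pos_on (hint a b) hpos hab
  refine ⟨fun t => 1 - I⁻¹ * ∫ s in a..t, β s, -I⁻¹, fun t ht => ?_, fun t ht => ?_, fun t => ?_⟩
  · simp only [hvanish fun _ hs h => (uIoc_of_ge ht ▸ hs).2.not_gt h.1, mul_zero, sub_zero]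
  · simp only [← intervalIntegral.integral_add_adjacent_intervals (hint a b) (hint b t),
      hvanish fun _ hs h => (uIoc_of_le ht ▸ hs).1.not_gt h.2, add_zero, ← hI,
      inv_mul_cancel₀ hIpos.ne', sub_self]
  · rw [neg_mul]
    exact ((hβ.integral_hasStrictDerivAt a t).hasDerivAt.const_mul I⁻¹).const_sub 1

lemma exists_isGevreyAt_cutoff {a b ε : ℝ} (hab : a < b) (hε : 0 < ε) :
    ∃ (χ : ℝ → ℂ) (C : ℝ), (∀ t ≤ a, χ t = 1) ∧ (∀ t, b ≤ t → χ t = 0) ∧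
      ∀ t, IsGevreyAt 2 C ε χ t := by
  obtain ⟨β, hβpos, hβzero, hβ⟩ := exists_isGevreyAt_bump a b hε
  have hβsmooth : ContDiff ℝ ∞ fun s => (β s : ℂ) :=
    contDiff_iff_contDiffAt.2 fun t => (hβ t).contDiffAt
  obtain ⟨χ, r, hχa, hχb, hχ⟩ := exists_hasDerivAt_const_mul_of_bump hab
    (Complex.continuous_re.comp hβsmooth.continuous) hβpos hβzero
  have hχd (t : ℝ) : HasDerivAt (fun t => (χ t : ℂ)) (r * β t) t := by
    exact_mod_cast (hχ t).ofReal_comp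
  have hχ' : deriv (fun t => (χ t : ℂ)) = (r : ℂ) • fun t => (β t : ℂ) :=
    funext fun t => (hχd t).deriv
  have hχsmooth : ContDiff ℝ ∞ fun t => (χ t : ℂ) := contDiff_infty_iff_deriv.2
    ⟨fun t => (hχd t).differentiableAt, by rw [hχ']; exact hβsmooth.const_smul (r : ℂ)⟩
  obtain ⟨C₀, hC₀⟩ := isCompact_Icc.exists_bound_of_continuousOn
    (hχsmooth.continuous.continuousOn (s := Icc a b))
  have hχbound (t : ℝ) : ‖(χ t : ℂ)‖ ≤ max C₀ 1 := by
    rcases le_total t a with h | h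
    · simp [hχa t h]
    rcases le_total b t with h' | h'
    · simp [hχb t h']
    · exact (hC₀ t ⟨h, h'⟩).trans (le_max_left _ _)
  exact ⟨fun t => χ t, _, fun t ht => by simp [hχa t ht], fun t ht => by simp [hχb t ht],
    fun t => .of_deriv hε hχsmooth.contDiffAt (hχbound t) (hχ' ▸ (hβ t).const_smul _)⟩

lemma exists_isGevreyAt_truncation {y : ℝ → ℂ} {a b C K ε : ℝ} (hab : a < b) (hK : 0 ≤ K)
    (hε : 0 < ε) (hy : ∀ t ≤ b, IsGevreyAt 1 C K y t) :
    ∃ (G : ℝ → ℂ) (C' : ℝ), (∀ t ≤ a, G t = y t) ∧ (∀ t, b ≤ t → G t = 0) ∧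
      ∀ t, IsGevreyAt 2 C' ε G t := by
  obtain ⟨χ, Cχ, hχa, hχb, hχ⟩ := exists_isGevreyAt_cutoff hab (half_pos hε)
  refine ⟨χ * y, Cχ * (C * Real.exp (K / (ε / 2))), fun t ht => by simp [hχa t ht],
    fun t ht => by simp [hχb t ht], fun t => ?_⟩
  have hmul (t : ℝ) (ht : t ≤ b) :
      IsGevreyAt 2 (Cχ * (C * Real.exp (K / (ε / 2)))) ε (χ * y) t := by
    have := (hχ t).mul (half_pos hε).le (half_pos hε).le ((hy t ht).succ_order (half_pos hε) hK)
    rwa [add_halves] at this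
  rcases le_or_gt t b with ht | ht
  · exact hmul t ht
  · refine (IsGevreyAt.const_zero ((norm_nonneg _).trans (hmul b le_rfl).norm_le) hε.le).congr ?_
    filter_upwards [eventually_gt_nhds ht] with s hs
    simp [hχb s hs.le]

end Gevrey

section PowerSeries

open scoped Nat

/-- The `k`-th space derivative of the power series `∑ₙ cₙ(t) xⁿ / n!`. It solves the heat equation
when `cₙ' = cₙ₊₂`, hence is determined by its Cauchy data `c₀`, `c₁` at `x = 0`. -/
noncomputable def lateralSeries (c : ℕ → ℝ → ℂ) (k : ℕ) (t x : ℝ) : ℂ :=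
  ∑' n, c (n + k) t * (x ^ n / n !)

variable {c : ℕ → ℝ → ℂ} {b : ℕ → ℝ} {L : ℝ}

lemma norm_mul_pow_div_factorial_le {z : ℂ} {r : ℝ} (hz : ‖z‖ ≤ r) (n : ℕ) {x : ℝ}
    (hx : x ∈ Icc (-L) L) : ‖z * (x ^ n / n !)‖ ≤ r * (L ^ n / n !) := by
  rw [norm_mul, norm_div, norm_pow, Complex.norm_real, Complex.norm_natCast, Real.norm_eq_abs]
  have := (norm_nonneg z).trans hz
  gcongr
  exact abs_le.2 hx

lemma summable_lateralSeries (hc : ∀ n t, ‖c n t‖ ≤ b n)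
    (hb : ∀ k, Summable fun n => b (n + k) * (L ^ n / n !)) (k : ℕ) (t : ℝ) {x : ℝ}
    (hx : x ∈ Icc (-L) L) : Summable fun n => c (n + k) t * (x ^ n / n !) :=
  .of_norm_bounded (hb k) fun _ => norm_mul_pow_div_factorial_le (hc _ t) _ hx

lemma continuousOn_lateralSeries (hc : ∀ n t, ‖c n t‖ ≤ b n)
    (hb : ∀ k, Summable fun n => b (n + k) * (L ^ n / n !)) (hcont : ∀ n, Continuous (c n))
    (k : ℕ) : ContinuousOn (fun p : ℝ × ℝ => lateralSeries c k p.1 p.2) (univ ×ˢ Icc (-L) L) := by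
  refine continuousOn_tsum (fun n => ?_) (hb k)
    fun n p hp => norm_mul_pow_div_factorial_le (hc _ p.1) _ hp.2
  have := hcont (n + k)
  fun_prop

lemma hasDerivAt_lateralSeries_time (hc : ∀ n t, ‖c n t‖ ≤ b n)
    (hb : ∀ k, Summable fun n => b (n + k) * (L ^ n / n !))
    (hd : ∀ n t, HasDerivAt (c n) (c (n + 2) t) t) (k : ℕ) (t : ℝ) {x : ℝ}
    (hx : x ∈ Icc (-L) L) :
    HasDerivAt (fun t => lateralSeries c k t x) (lateralSeries c (k + 2) t x) t :=
  hasDerivAt_tsum (hb (k + 2)) (fun n s => (hd (n + k) s).mul_const _)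
    (fun _ s => norm_mul_pow_div_factorial_le (hc _ s) _ hx)
    (summable_lateralSeries hc hb k t hx) t

lemma hasDerivAt_pow_div_factorial (n : ℕ) (x : ℝ) :
    HasDerivAt (fun x : ℝ => (x : ℂ) ^ (n + 1) / (n + 1)!) (x ^ n / n !) x := by
  have hpow : HasDerivAt (fun x : ℝ => (x : ℂ) ^ (n + 1)) ((n + 1 : ℕ) * (x : ℂ) ^ n) x := by
    simpa using (hasDerivAt_pow (n + 1) (x : ℂ)).comp_ofReal
  refine (hpow.div_const _).congr_deriv ?_
  rw [Nat.factorial_succ, Nat.cast_mul, mul_div_mul_left _ _ (mod_cast n.succ_ne_zero)]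

lemma hasDerivAt_lateralSeries_space (hc : ∀ n t, ‖c n t‖ ≤ b n)
    (hb : ∀ k, Summable fun n => b (n + k) * (L ^ n / n !)) (k : ℕ) (t : ℝ) {x : ℝ}
    (hx : x ∈ Ioo (-L) L) :
    HasDerivAt (lateralSeries c k t) (lateralSeries c (k + 1) t x) x := by
  have hsum {x : ℝ} (hx : x ∈ Ioo (-L) L) :=
    summable_lateralSeries hc hb k t (Ioo_subset_Icc_self hx)
  have hshift (n : ℕ) : n + 1 + k = n + (k + 1) := by ring
  have htail : HasDerivAt (fun x : ℝ => ∑' n, c (n + 1 + k) t * ((x : ℂ) ^ (n + 1) / (n + 1)!))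
      (∑' n, c (n + 1 + k) t * (x ^ n / n !)) x :=
    hasDerivAt_tsum_of_isPreconnected (by simpa only [hshift] using hb (k + 1)) isOpen_Ioo
      isPreconnected_Ioo (fun n y _ => (hasDerivAt_pow_div_factorial n y).const_mul _)
      (fun n y hy => norm_mul_pow_div_factorial_le
        (by simpa only [hshift] using hc (n + (k + 1)) t) n (Ioo_subset_Icc_self hy))
      hx ((summable_nat_add_iff 1).2 (hsum hx)) hx
  simp only [hshift] at htail
  refine (htail.const_add (c k t)).congr_of_eventuallyEq ?_
  filter_upwards [isOpen_Ioo.mem_nhds hx] with y hy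
  rw [lateralSeries, (hsum hy).tsum_eq_zero_add]
  simp [hshift]

lemma isClassicalSolution_lateralSeries (T : ℝ) (hc : ∀ n t, ‖c n t‖ ≤ b n)
    (hb : ∀ k, Summable fun n => b (n + k) * (L ^ n / n !))
    (hd : ∀ n t, HasDerivAt (c n) (c (n + 2) t) t) :
    IsClassicalSolution L T (lateralSeries c 0) (lateralSeries c 1) (lateralSeries c 2) := by
  have hcont (k : ℕ) : ContinuousOn (fun p : ℝ × ℝ => lateralSeries c k p.1 p.2)
      (Icc 0 T ×ˢ Icc (-L) L) :=
    (continuousOn_lateralSeries hc hb (fun n => continuous_iff_continuousAt.2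
      fun t => (hd n t).continuousAt) k).mono (prod_mono_left (subset_univ _))
  exact
    { continuousOn := hcont 0
      continuousOn_dx := hcont 1
      continuousOn_dxx := hcont 2
      hasDerivAt_dx t _ _ hx := hasDerivAt_lateralSeries_space hc hb 0 t hx
      hasDerivAt_dxx t _ _ hx := hasDerivAt_lateralSeries_space hc hb 1 t hx
      hasDerivAt_dt t _ _ hx := hasDerivAt_lateralSeries_time hc hb hd 0 t
        (Ioo_subset_Icc_self hx) }

lemma summable_factorial_mul_pow_div_factorial {q ρ : ℝ} (C : ℝ) (h : |q * ρ| < 1) (k : ℕ) :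
    Summable fun n => C * q ^ (n + k) * (n + k)! * (ρ ^ n / n !) := by
  refine ((summable_descFactorial_mul_geometric_of_norm_lt_one k h).mul_left (C * q ^ k)).congr
    fun n => ?_
  have hfac : ((n + k)! : ℝ) = n ! * (n + k).descFactorial k := by
    have := Nat.factorial_mul_descFactorial (Nat.le_add_left k n)
    rw [Nat.add_sub_cancel] at this
    exact_mod_cast this.symm
  rw [hfac, mul_pow, pow_add]
  field_simp

end PowerSeries

section LateralData

open scoped Nat

lemma norm_iteratedDeriv_half_le {G : ℕ → ℝ → ℂ} {C : ℕ → ℝ} {q t : ℝ} (hq : 0 < q) (hq1 : q ≤ 1)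
    (hG : ∀ j, IsGevreyAt 2 (C j) (q ^ 2) (G j) t) (n : ℕ) :
    ‖iteratedDeriv (n / 2) (G (n % 2)) t‖ ≤ (C 0 + C 1) / q * q ^ n * n ! := by
  have hC (j : ℕ) : 0 ≤ C j := (norm_nonneg _).trans (hG j).norm_le
  have hCle : C (n % 2) ≤ C 0 + C 1 := by
    rcases Nat.mod_two_eq_zero_or_one n with h | h <;> rw [h] <;> linarith [hC 0, hC 1]
  have hpow : (q ^ 2) ^ (n / 2) ≤ q ^ n / q := by
    rw [le_div_iff₀ hq, ← pow_mul, ← pow_succ]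
    exact pow_le_pow_of_le_one hq.le hq1 (by lia)
  have hfac : ((n / 2)! : ℝ) ^ 2 ≤ n ! := by
    have hdvd := Nat.factorial_mul_factorial_dvd_factorial (n.div_le_self 2)
    have hle := Nat.factorial_le (show n / 2 ≤ n - n / 2 by lia)
    rw [sq]
    exact_mod_cast (Nat.mul_le_mul_left _ hle).trans (Nat.le_of_dvd n.factorial_pos hdvd)
  calc ‖iteratedDeriv (n / 2) (G (n % 2)) t‖
      ≤ C (n % 2) * (q ^ 2) ^ (n / 2) * ((n / 2)! : ℝ) ^ 2 :=
        (hG (n % 2)).norm_iteratedDeriv_le (n / 2)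
    _ ≤ (C 0 + C 1) * (q ^ n / q) * n ! := by
        have := (hC _).trans hCle
        gcongr
    _ = (C 0 + C 1) / q * q ^ n * n ! := by ring

lemma hasDerivAt_iteratedDeriv_half {G : ℕ → ℝ → ℂ} (hG : ∀ j, ContDiff ℝ ∞ (G j)) (n : ℕ)
    (t : ℝ) :
    HasDerivAt (iteratedDeriv (n / 2) (G (n % 2)))
      (iteratedDeriv ((n + 2) / 2) (G ((n + 2) % 2)) t) t := by
  rw [Nat.add_mod_right, Nat.add_div_right n two_pos, iteratedDeriv_succ]
  exact ((hG (n % 2)).differentiable_iteratedDeriv _ (mod_cast WithTop.coe_lt_top _) t).hasDerivAt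

-- The Cauchy data `u(·, 0)`, `∂ₓu(·, 0)` are the Gevrey functions `y 0`, `y 1`; cutting them off in
-- time produces a solution equal to `u` at time `0` and vanishing at time `T`, to be subtracted.
lemma mem_classicallyReachable_of_isGevreyAt {L T b K : ℝ} {u ux uxx : ℝ → ℝ → ℂ} {y : ℕ → ℝ → ℂ}
    {C : ℕ → ℝ} (hL : 0 ≤ L) (hb : 0 < b) (hbT : b < T) (hK : 0 ≤ K)
    (hu : IsClassicalSolution L T u ux uxx) (hy : ∀ j, ∀ t ≤ b, IsGevreyAt 1 (C j) K (y j) t)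
    (hy0 : ∀ x ∈ Ioo (-L) L,
      HasSum (fun n => iteratedDeriv (n / 2) (y (n % 2)) 0 * (x ^ n / n !)) (u 0 x)) :
    u T ∈ classicallyReachable L T := by
  set q : ℝ := (L + 1)⁻¹ with hqdef
  have hq : 0 < q := by positivity
  have hq1 : q ≤ 1 := inv_le_one_of_one_le₀ (by linarith)
  have hqL : |q * L| < 1 := by
    rw [abs_of_nonneg (by positivity), hqdef, inv_mul_lt_one₀ (by positivity)]
    exact lt_add_one L
  choose G C' hGa hGb hG using fun j =>
    exists_isGevreyAt_truncation (half_lt_self hb) hK (pow_pos hq 2) (hy j)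
  set c : ℕ → ℝ → ℂ := fun n => iteratedDeriv (n / 2) (G (n % 2))
  have hseries : IsClassicalSolution L T (lateralSeries c 0) (lateralSeries c 1)
      (lateralSeries c 2) :=
    isClassicalSolution_lateralSeries T
      (fun n t => norm_iteratedDeriv_half_le hq hq1 (fun j => hG j t) n)
      (summable_factorial_mul_pow_div_factorial _ hqL)
      (hasDerivAt_iteratedDeriv_half fun j =>
        contDiff_iff_contDiffAt.2 fun t => (hG j t).contDiffAt)
  have hinit (n : ℕ) : c n 0 = iteratedDeriv (n / 2) (y (n % 2)) 0 := by
    refine Filter.EventuallyEq.iteratedDeriv_eq _ ?_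
    filter_upwards [Iic_mem_nhds (half_pos hb)] with t ht using hGa _ t ht
  have hfinal (n : ℕ) : c n T = 0 := by
    have hev : G (n % 2) =ᶠ[𝓝 T] fun _ => 0 := by
      filter_upwards [Ici_mem_nhds hbT] with t ht using hGb _ t ht
    exact (hev.iteratedDeriv_eq _).trans (by rw [iteratedDeriv_const, ite_self])
  refine ⟨_, _, _, hu.add (hseries.const_smul (-1)), fun x hx => ?_, fun x _ => ?_⟩
  · simp [lateralSeries, hinit, (hy0 x hx).tsum_eq]
  · simp [lateralSeries, hfinal]

end LateralData

section DerivativeTower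

variable {E : Type*} [NormedAddCommGroup E] [NormedSpace ℝ E] {f : ℕ → ℝ → E} {s : Set ℝ}

lemma iteratedDeriv_eq_of_hasDerivAt_succ (hs : IsOpen s)
    (hf : ∀ i, ∀ t ∈ s, HasDerivAt (f i) (f (i + 1) t) t) (i : ℕ) {t : ℝ} (ht : t ∈ s) :
    iteratedDeriv i (f 0) t = f i t := by
  induction i generalizing t with
  | zero => rfl
  | succ i ih =>
    have hev : iteratedDeriv i (f 0) =ᶠ[𝓝 t] f i := by
      filter_upwards [hs.mem_nhds ht] with s hs using ih hs
    rw [iteratedDeriv_succ, hev.deriv_eq, (hf i t ht).deriv]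

lemma contDiffOn_of_hasDerivAt_succ (hs : IsOpen s)
    (hf : ∀ i, ∀ t ∈ s, HasDerivAt (f i) (f (i + 1) t) t) (i : ℕ) : ContDiffOn ℝ ∞ (f i) s := by
  refine contDiffOn_infty.2 fun n => ?_
  induction n generalizing i with
  | zero =>
    rw [Nat.cast_zero, contDiffOn_zero]
    exact fun t ht => (hf i t ht).continuousAt.continuousWithinAt
  | succ n ih =>
    rw [Nat.cast_succ, contDiffOn_succ_iff_deriv_of_isOpen hs]
    exact ⟨fun t ht => (hf i t ht).differentiableAt.differentiableWithinAt, by simp,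
      (ih (i + 1)).congr fun t ht => (hf i t ht).deriv⟩

end DerivativeTower

section Superposition

open scoped Nat

variable {Ω : Type*} [MeasurableSpace Ω]

/-- The `k`-th space derivative of the superposition, with amplitudes `A` and frequencies `Λ`, of
the exponential solutions `exp (λ x + λ² (t - T))` of the heat equation. -/
noncomputable def expSuperposition (ν : Measure Ω) (A Λ : Ω → ℂ) (T : ℝ) (k : ℕ) (t x : ℝ) : ℂ :=
  ∫ s, A s * Λ s ^ k * Complex.exp (Λ s * x + Λ s ^ 2 * (t - T)) ∂ν

/-- The hypotheses under which `expSuperposition` converges for `|x| ≤ L` and `t ≤ T`, with all its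
derivatives, and is regularizing for `t < T`: the frequencies lie in the cone `Re λ² ≥ κ |λ|²`. -/
structure IsAdmissible (ν : Measure Ω) (A Λ : Ω → ℂ) (L κ : ℝ) : Prop where
  aestronglyMeasurable_amplitude : AEStronglyMeasurable A ν
  aestronglyMeasurable_frequency : AEStronglyMeasurable Λ ν
  cone_pos : 0 < κ
  le_re_sq : ∀ s, κ * ‖Λ s‖ ^ 2 ≤ (Λ s ^ 2).re
  integrable : ∀ k : ℕ,
    Integrable (fun s => ‖A s‖ * ‖Λ s‖ ^ k * Real.exp (L * |(Λ s).re|)) ν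

lemma norm_exp_heat_le {z : ℂ} {κ L τ x : ℝ} (hz : κ * ‖z‖ ^ 2 ≤ (z ^ 2).re) (hτ : τ ≤ 0)
    (hx : x ∈ Icc (-L) L) :
    ‖Complex.exp (z * x + z ^ 2 * τ)‖ ≤ Real.exp (L * |z.re|) * Real.exp (κ * ‖z‖ ^ 2 * τ) := by
  have hzx : z.re * x ≤ L * |z.re| := by
    rw [mul_comm L]
    exact (le_abs_self _).trans ((abs_mul _ _).trans_le
      (mul_le_mul_of_nonneg_left (abs_le.2 hx) (abs_nonneg _)))
  rw [Complex.norm_exp, ← Real.exp_add, Complex.add_re, Complex.re_mul_ofReal,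
    Complex.re_mul_ofReal]
  exact Real.exp_le_exp.2 (add_le_add hzx (mul_le_mul_of_nonpos_right hz hτ))

namespace IsAdmissible

variable {ν : Measure Ω} {A Λ : Ω → ℂ} {L T κ : ℝ}

lemma aestronglyMeasurable_integrand (h : IsAdmissible ν A Λ L κ) (T : ℝ) (k : ℕ) (t x : ℝ) :
    AEStronglyMeasurable
      (fun s => A s * Λ s ^ k * Complex.exp (Λ s * x + Λ s ^ 2 * (t - T))) ν := by
  have hΛ := h.aestronglyMeasurable_frequency
  exact (h.aestronglyMeasurable_amplitude.mul (hΛ.pow k)).mul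
    (Complex.continuous_exp.comp_aestronglyMeasurable
      ((hΛ.mul_const _).add ((hΛ.pow 2).mul_const _)))

lemma norm_integrand_le_mul_exp (h : IsAdmissible ν A Λ L κ) (k : ℕ) {t x : ℝ} (ht : t ≤ T)
    (hx : x ∈ Icc (-L) L) (s : Ω) :
    ‖A s * Λ s ^ k * Complex.exp (Λ s * x + Λ s ^ 2 * (t - T))‖ ≤
      ‖A s‖ * ‖Λ s‖ ^ k * Real.exp (L * |(Λ s).re|) * Real.exp (κ * ‖Λ s‖ ^ 2 * (t - T)) := by
  rw [norm_mul, norm_mul, norm_pow, mul_assoc (_ * _)]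
  gcongr
  exact_mod_cast norm_exp_heat_le (h.le_re_sq s) (sub_nonpos.2 ht) hx

lemma norm_integrand_le (h : IsAdmissible ν A Λ L κ) (k : ℕ) {t x : ℝ} (ht : t ≤ T)
    (hx : x ∈ Icc (-L) L) (s : Ω) :
    ‖A s * Λ s ^ k * Complex.exp (Λ s * x + Λ s ^ 2 * (t - T))‖ ≤
      ‖A s‖ * ‖Λ s‖ ^ k * Real.exp (L * |(Λ s).re|) := by
  refine (h.norm_integrand_le_mul_exp k ht hx s).trans
    (mul_le_of_le_one_right (by positivity) (Real.exp_le_one_iff.2 ?_))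
  exact mul_nonpos_of_nonneg_of_nonpos (mul_nonneg h.cone_pos.le (sq_nonneg _)) (sub_nonpos.2 ht)

lemma integrable_integrand (h : IsAdmissible ν A Λ L κ) (k : ℕ) {t x : ℝ} (ht : t ≤ T)
    (hx : x ∈ Icc (-L) L) :
    Integrable (fun s => A s * Λ s ^ k * Complex.exp (Λ s * x + Λ s ^ 2 * (t - T))) ν :=
  (h.integrable k).mono' (h.aestronglyMeasurable_integrand T k t x)
    (.of_forall (h.norm_integrand_le k ht hx))

lemma continuousOn_expSuperposition (h : IsAdmissible ν A Λ L κ) (T : ℝ) (k : ℕ) :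
    ContinuousOn (fun p : ℝ × ℝ => expSuperposition ν A Λ T k p.1 p.2)
      (Iic T ×ˢ Icc (-L) L) :=
  continuousOn_of_dominated (fun p _ => h.aestronglyMeasurable_integrand T k p.1 p.2)
    (fun _ hp => .of_forall (h.norm_integrand_le k hp.1 hp.2)) (h.integrable k)
    (.of_forall fun s => by fun_prop)

lemma hasDerivAt_expSuperposition_space (h : IsAdmissible ν A Λ L κ) (k : ℕ) {t x : ℝ}
    (ht : t ≤ T) (hx : x ∈ Ioo (-L) L) :
    HasDerivAt (expSuperposition ν A Λ T k t) (expSuperposition ν A Λ T (k + 1) t x) x := by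
  refine (hasDerivAt_integral_of_dominated_loc_of_deriv_le (isOpen_Ioo.mem_nhds hx)
    (.of_forall (h.aestronglyMeasurable_integrand T k t))
    (h.integrable_integrand k ht (Ioo_subset_Icc_self hx))
    (h.aestronglyMeasurable_integrand T (k + 1) t x)
    (.of_forall fun s x hx => h.norm_integrand_le (k + 1) ht (Ioo_subset_Icc_self hx) s)
    (h.integrable (k + 1)) (.of_forall fun s x _ => ?_)).2
  have hexponent : HasDerivAt (fun x : ℝ => Λ s * x + Λ s ^ 2 * (t - T)) (Λ s) x := by
    simpa using (Complex.ofRealCLM.hasDerivAt.const_mul (Λ s)).add_const (Λ s ^ 2 * (t - T))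
  exact (hexponent.cexp.const_mul (A s * Λ s ^ k)).congr_deriv (by ring)

lemma hasDerivAt_expSuperposition_time (h : IsAdmissible ν A Λ L κ) (k : ℕ) {t x : ℝ} (ht : t < T)
    (hx : x ∈ Icc (-L) L) :
    HasDerivAt (fun t => expSuperposition ν A Λ T k t x)
      (expSuperposition ν A Λ T (k + 2) t x) t := by
  refine (hasDerivAt_integral_of_dominated_loc_of_deriv_le (Iio_mem_nhds ht)
    (.of_forall fun t => h.aestronglyMeasurable_integrand T k t x)
    (h.integrable_integrand k ht.le hx)
    (h.aestronglyMeasurable_integrand T (k + 2) t x)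
    (.of_forall fun s t ht => h.norm_integrand_le (k + 2) (le_of_lt ht) hx s)
    (h.integrable (k + 2)) (.of_forall fun s t _ => ?_)).2
  have hexponent : HasDerivAt (fun t : ℝ => Λ s * x + Λ s ^ 2 * (t - T)) (Λ s ^ 2) t := by
    simpa using ((Complex.ofRealCLM.hasDerivAt.sub_const (T : ℂ)).const_mul
      (Λ s ^ 2)).const_add (Λ s * x)
  exact (hexponent.cexp.const_mul (A s * Λ s ^ k)).congr_deriv (by ring)

lemma isClassicalSolution (h : IsAdmissible ν A Λ L κ) :
    IsClassicalSolution L T (expSuperposition ν A Λ T 0) (expSuperposition ν A Λ T 1)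
      (expSuperposition ν A Λ T 2) := by
  have hcont (k : ℕ) := (h.continuousOn_expSuperposition T k).mono
    (prod_mono_left (Icc_subset_Iic_self (a := 0)))
  exact
    { continuousOn := hcont 0
      continuousOn_dx := hcont 1
      continuousOn_dxx := hcont 2
      hasDerivAt_dx _ ht _ hx := h.hasDerivAt_expSuperposition_space 0 ht.2.le hx
      hasDerivAt_dxx _ ht _ hx := h.hasDerivAt_expSuperposition_space 1 ht.2.le hx
      hasDerivAt_dt _ ht _ hx :=
        h.hasDerivAt_expSuperposition_time 0 ht.2 (Ioo_subset_Icc_self hx) }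

lemma hasDerivAt_lateral_expSuperposition (h : IsAdmissible ν A Λ L κ) (hL : 0 ≤ L) (j i : ℕ)
    {t : ℝ} (ht : t ∈ Iio T) :
    HasDerivAt (fun t => expSuperposition ν A Λ T (j + 2 * i) t 0)
      (expSuperposition ν A Λ T (j + 2 * (i + 1)) t 0) t :=
  h.hasDerivAt_expSuperposition_time (j + 2 * i) ht ⟨neg_nonpos.2 hL, hL⟩

lemma iteratedDeriv_lateral_expSuperposition (h : IsAdmissible ν A Λ L κ) (hL : 0 ≤ L) (j i : ℕ)
    {t : ℝ} (ht : t < T) :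
    iteratedDeriv i (fun t => expSuperposition ν A Λ T j t 0) t =
      expSuperposition ν A Λ T (j + 2 * i) t 0 :=
  iteratedDeriv_eq_of_hasDerivAt_succ (f := fun i t => expSuperposition ν A Λ T (j + 2 * i) t 0)
    isOpen_Iio (fun i _ => h.hasDerivAt_lateral_expSuperposition hL j i) i ht

lemma isGevreyAt_lateral_expSuperposition (h : IsAdmissible ν A Λ L κ) (hL : 0 ≤ L) (j : ℕ)
    {b t : ℝ} (hb : b < T) (ht : t ≤ b) :
    IsGevreyAt 1 (∫ s, ‖A s‖ * ‖Λ s‖ ^ j * Real.exp (L * |(Λ s).re|) ∂ν) (κ * (T - b))⁻¹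
      (fun t => expSuperposition ν A Λ T j t 0) t where
  contDiffAt := (contDiffOn_of_hasDerivAt_succ isOpen_Iio
    (fun i _ => h.hasDerivAt_lateral_expSuperposition hL j i) 0).contDiffAt
    (Iio_mem_nhds (ht.trans_lt hb))
  norm_iteratedDeriv_le i := by
    have hδ : 0 < κ * (T - b) := mul_pos h.cone_pos (sub_pos.2 hb)
    rw [h.iteratedDeriv_lateral_expSuperposition hL j i (ht.trans_lt hb), pow_one, mul_assoc,
      ← integral_mul_const]
    refine norm_integral_le_of_norm_le ((h.integrable j).mul_const _) (.of_forall fun s => ?_)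
    have hpow : ‖Λ s‖ ^ (2 * i) * Real.exp (κ * ‖Λ s‖ ^ 2 * (t - T)) ≤
        (κ * (T - b))⁻¹ ^ i * i ! := by
      have hexp := Real.pow_div_factorial_le_exp (κ * (T - b) * ‖Λ s‖ ^ 2) (by positivity) i
      rw [div_le_iff₀ (by positivity), mul_pow, ← pow_mul] at hexp
      have hle : κ * ‖Λ s‖ ^ 2 * (t - T) ≤ -(κ * (T - b) * ‖Λ s‖ ^ 2) := by
        have := mul_le_mul_of_nonneg_left ht (mul_nonneg h.cone_pos.le (sq_nonneg ‖Λ s‖))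
        linarith
      grw [hle]
      rw [Real.exp_neg, inv_pow, ← div_eq_mul_inv, div_le_iff₀ (Real.exp_pos _), mul_assoc,
        le_inv_mul_iff₀ (by positivity), mul_comm (i ! : ℝ)]
      exact hexp
    refine (h.norm_integrand_le_mul_exp (j + 2 * i) (ht.trans hb.le)
      ⟨neg_nonpos.2 hL, hL⟩ s).trans ?_
    rw [pow_add, show ‖A s‖ * (‖Λ s‖ ^ j * ‖Λ s‖ ^ (2 * i)) * Real.exp (L * |(Λ s).re|) *
      Real.exp (κ * ‖Λ s‖ ^ 2 * (t - T)) = ‖A s‖ * ‖Λ s‖ ^ j * Real.exp (L * |(Λ s).re|) *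
        (‖Λ s‖ ^ (2 * i) * Real.exp (κ * ‖Λ s‖ ^ 2 * (t - T))) by ring]
    gcongr

lemma integrable_exp_amplitude (h : IsAdmissible ν A Λ L κ) (hL : 0 ≤ L) (x : ℝ) {τ : ℝ}
    (hτ : 0 < τ) :
    Integrable (fun s => ‖A s‖ * Real.exp (‖Λ s‖ * |x|) * Real.exp (-(κ * τ * ‖Λ s‖ ^ 2))) ν := by
  have hκτ : 0 < κ * τ := mul_pos h.cone_pos hτ
  have hΛ := h.aestronglyMeasurable_frequency.norm
  refine ((h.integrable 0).mul_const (Real.exp (x ^ 2 / (4 * (κ * τ))))).mono'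
    ((h.aestronglyMeasurable_amplitude.norm.mul
      (Real.continuous_exp.comp_aestronglyMeasurable (hΛ.mul_const _))).mul
      (Real.continuous_exp.comp_aestronglyMeasurable ((hΛ.pow 2).const_mul _).neg))
    (.of_forall fun s => ?_)
  have hsq : ‖Λ s‖ * |x| - κ * τ * ‖Λ s‖ ^ 2 ≤ x ^ 2 / (4 * (κ * τ)) := by
    rw [le_div_iff₀ (by positivity), ← sq_abs x]
    linarith [sq_nonneg (|x| - 2 * (κ * τ) * ‖Λ s‖)]
  rw [Real.norm_of_nonneg (by positivity), mul_assoc, ← Real.exp_add, ← sub_eq_add_neg, pow_zero,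
    mul_one]
  gcongr
  exact le_mul_of_one_le_right (norm_nonneg _) (Real.one_le_exp (by positivity))

lemma norm_mul_pow_mul_exp_sq_le (h : IsAdmissible ν A Λ L κ) {t : ℝ} (ht : t ≤ T) (x : ℝ) (n : ℕ)
    (s : Ω) :
    ‖A s * Λ s ^ n * Complex.exp (Λ s ^ 2 * (t - T)) * (x ^ n / n !)‖ ≤
      ‖A s‖ * ((‖Λ s‖ * |x|) ^ n / n !) * Real.exp (-(κ * (T - t) * ‖Λ s‖ ^ 2)) := by
  have hexp : ‖Complex.exp (Λ s ^ 2 * (t - T))‖ ≤ Real.exp (-(κ * (T - t) * ‖Λ s‖ ^ 2)) := by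
    rw [Complex.norm_exp, ← Complex.ofReal_sub, Complex.re_mul_ofReal]
    refine Real.exp_le_exp.2 ?_
    linarith [mul_le_mul_of_nonneg_right (h.le_re_sq s) (sub_nonneg.2 ht)]
  rw [norm_mul, norm_mul, norm_mul, norm_pow, norm_div, norm_pow, Complex.norm_real,
    Complex.norm_natCast, Real.norm_eq_abs, mul_pow]
  calc ‖A s‖ * ‖Λ s‖ ^ n * ‖Complex.exp (Λ s ^ 2 * (t - T))‖ * (|x| ^ n / n !)
      ≤ ‖A s‖ * ‖Λ s‖ ^ n * Real.exp (-(κ * (T - t) * ‖Λ s‖ ^ 2)) * (|x| ^ n / n !) := by gcongr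
    _ = _ := by ring

lemma hasSum_expSuperposition (h : IsAdmissible ν A Λ L κ) (hL : 0 ≤ L) {t : ℝ} (ht : t < T)
    (x : ℝ) :
    HasSum (fun n => expSuperposition ν A Λ T n t 0 * (x ^ n / n !))
      (expSuperposition ν A Λ T 0 t x) := by
  have hreal (r : ℝ) : HasSum (fun n => r ^ n / n !) (Real.exp r) := by
    rw [Real.exp_eq_exp_ℝ]
    exact NormedSpace.expSeries_div_hasSum_exp r
  have hcomplex (z : ℂ) : HasSum (fun n => z ^ n / n !) (Complex.exp z) := by
    rw [Complex.exp_eq_exp_ℂ]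
    exact NormedSpace.expSeries_div_hasSum_exp z
  have hbound (s : Ω) := ((hreal (‖Λ s‖ * |x|)).mul_left ‖A s‖).mul_right
    (Real.exp (-(κ * (T - t) * ‖Λ s‖ ^ 2)))
  simp only [expSuperposition, ← integral_mul_const, pow_zero, mul_one, Complex.ofReal_zero,
    mul_zero, zero_add]
  refine hasSum_integral_of_dominated_convergence _ (fun n => ?_)
    (fun n => .of_forall (h.norm_mul_pow_mul_exp_sq_le ht.le x n))
    (.of_forall fun s => (hbound s).summable) ?_ (.of_forall fun s => ?_)
  · simpa using (h.aestronglyMeasurable_integrand T n t 0).mul_const ((x : ℂ) ^ n / n !)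
  · simp only [(hbound _).tsum_eq]
    exact h.integrable_exp_amplitude hL x (sub_pos.2 ht)
  · rw [Complex.exp_add, ← mul_assoc]
    refine (((hcomplex (Λ s * x)).mul_left (A s)).mul_right _).congr_fun fun n => ?_
    rw [mul_pow]
    ring

lemma mem_classicallyReachable (h : IsAdmissible ν A Λ L κ) (hL : 0 ≤ L) (hT : 0 < T) :
    (fun x : ℝ => ∫ s, A s * Complex.exp (Λ s * x) ∂ν) ∈ classicallyReachable L T := by
  have hfinal : expSuperposition ν A Λ T 0 T =
      fun x : ℝ => ∫ s, A s * Complex.exp (Λ s * x) ∂ν := by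
    funext x
    simp [expSuperposition]
  rw [← hfinal]
  refine mem_classicallyReachable_of_isGevreyAt hL (half_pos hT) (half_lt_self hT)
    (inv_nonneg.2 (mul_nonneg h.cone_pos.le (sub_nonneg.2 (half_le_self hT.le))))
    h.isClassicalSolution
    (fun j _ => h.isGevreyAt_lateral_expSuperposition hL j (half_lt_self hT)) fun x _ => ?_
  simpa only [h.iteratedDeriv_lateral_expSuperposition hL _ _ hT, Nat.mod_add_div] using
    h.hasSum_expSuperposition hL hT x

end IsAdmissible

end Superposition

section CauchyIntegral

lemma integral_mul_exp_neg_mul_eq_inv {σ w : ℂ} (h : 0 < (σ * w).re) :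
    ∫ r : ℝ in Ioi 0, σ * Complex.exp (-(r * (σ * w))) = w⁻¹ := by
  have hσ : σ ≠ 0 := by
    rintro rfl
    simp at h
  have hint := integral_exp_mul_complex_Ioi (a := -(σ * w)) (by simpa using h) 0
  rw [Complex.ofReal_zero, mul_zero, Complex.exp_zero, neg_div_neg_eq] at hint
  calc ∫ r : ℝ in Ioi 0, σ * Complex.exp (-(r * (σ * w)))
      = σ * ∫ r : ℝ in Ioi 0, Complex.exp (-(σ * w) * r) := by
        rw [integral_const_mul]
        congr! 4
        ring
    _ = w⁻¹ := by rw [hint, one_div, mul_inv, mul_inv_cancel_left₀ hσ]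

lemma integrableOn_pow_mul_exp_neg_mul (k : ℕ) {δ : ℝ} (hδ : 0 < δ) :
    IntegrableOn (fun r : ℝ => r ^ k * Real.exp (-(δ * r))) (Ioi 0) := by
  have := integrableOn_rpow_mul_exp_neg_mul_rpow (s := k) (p := 1) (b := δ)
    (by linarith [k.cast_nonneg (α := ℝ)]) one_pos hδ
  simpa only [Real.rpow_natCast, Real.rpow_one, neg_mul] using this

variable {S : Type*} [MeasurableSpace S] {μ : Measure S} {g ζ : S → ℂ} {L T : ℝ}

lemma isAdmissible_laplace_cauchyKernel {σ : ℂ} {δ : ℝ} (hg : Integrable g μ)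
    (hζ : AEStronglyMeasurable ζ μ) (hσ : 0 < (σ ^ 2).re) (hδ : 0 < δ)
    (hre : ∀ᵐ s ∂μ, δ + L * |σ.re| ≤ (σ * ζ s).re) :
    IsAdmissible ((volume.restrict (Ioi (0 : ℝ))).prod μ)
      (fun p => g p.2 * (σ * Complex.exp (-(p.1 * (σ * ζ p.2))))) (fun p => p.1 * σ) L
      ((σ ^ 2).re / ‖σ‖ ^ 2) := by
  have hσn : 0 < ‖σ‖ := by
    rw [norm_pos_iff]
    rintro rfl
    simp at hσ
  have hr : AEStronglyMeasurable (fun p : ℝ × S => (p.1 : ℂ))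
      ((volume.restrict (Ioi (0 : ℝ))).prod μ) :=
    Complex.continuous_ofReal.aestronglyMeasurable.comp_fst
  have hA := hg.aestronglyMeasurable.comp_snd.mul
    ((Complex.continuous_exp.comp_aestronglyMeasurable
      (hr.mul (hζ.comp_snd.const_mul σ)).neg).const_mul σ)
  refine ⟨hA, hr.mul_const σ, by positivity, fun p => ?_, fun k => ?_⟩
  · rw [norm_mul, mul_pow, mul_pow, ← Complex.ofReal_pow, Complex.re_ofReal_mul, Complex.norm_real,
      Real.norm_eq_abs, sq_abs]
    field_simp
    rfl
  · refine ((integrableOn_pow_mul_exp_neg_mul k hδ).mul_prod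
      (hg.norm.mul_const (‖σ‖ ^ (k + 1)))).mono'
      ((hA.norm.mul ((hr.mul_const σ).norm.pow k)).mul
        (Real.continuous_exp.comp_aestronglyMeasurable
          ((continuous_abs.comp Complex.continuous_re).comp_aestronglyMeasurable
            (hr.mul_const σ) |>.const_mul L))) ?_
    filter_upwards [Measure.quasiMeasurePreserving_fst.ae (ae_restrict_mem measurableSet_Ioi),
      Measure.quasiMeasurePreserving_snd.ae hre] with p hp hre
    have hp : 0 < p.1 := hp
    rw [Real.norm_of_nonneg (by positivity), norm_mul, norm_mul, norm_mul, Complex.norm_exp,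
      Complex.norm_real, Real.norm_of_nonneg hp.le, Complex.neg_re, Complex.re_ofReal_mul,
      Complex.re_ofReal_mul, abs_mul, abs_of_pos hp]
    have hexp : Real.exp (-(p.1 * (σ * ζ p.2).re)) * Real.exp (L * (p.1 * |σ.re|)) ≤
        Real.exp (-(δ * p.1)) := by
      rw [← Real.exp_add, Real.exp_le_exp]
      linarith [mul_le_mul_of_nonneg_left hre hp.le]
    calc ‖g p.2‖ * (‖σ‖ * Real.exp (-(p.1 * (σ * ζ p.2).re))) * (p.1 * ‖σ‖) ^ k *
          Real.exp (L * (p.1 * |σ.re|))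
        = p.1 ^ k * (‖g p.2‖ * ‖σ‖ ^ (k + 1)) *
          (Real.exp (-(p.1 * (σ * ζ p.2).re)) * Real.exp (L * (p.1 * |σ.re|))) := by ring
      _ ≤ p.1 ^ k * (‖g p.2‖ * ‖σ‖ ^ (k + 1)) * Real.exp (-(δ * p.1)) := by gcongr
      _ = p.1 ^ k * Real.exp (-(δ * p.1)) * (‖g p.2‖ * ‖σ‖ ^ (k + 1)) := by ring

lemma cauchyIntegral_mem_classicallyReachable [SFinite μ] {σ : ℂ} {δ : ℝ} (hg : Integrable g μ)
    (hζ : AEStronglyMeasurable ζ μ) (hσ : 0 < (σ ^ 2).re) (hδ : 0 < δ)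
    (hre : ∀ᵐ s ∂μ, δ + L * |σ.re| ≤ (σ * ζ s).re) (hL : 0 ≤ L) (hT : 0 < T) :
    (fun x : ℝ => ∫ s, g s / (ζ s - x) ∂μ) ∈ classicallyReachable L T := by
  have hadm := isAdmissible_laplace_cauchyKernel hg hζ hσ hδ hre
  refine (classicallyReachable_congr fun x hx => ?_).1 (hadm.mem_classicallyReachable hL hT)
  have hint := hadm.integrable_integrand 0 le_rfl (Ioo_subset_Icc_self hx) (T := T)
  simp only [pow_zero, mul_one, sub_self, mul_zero, add_zero] at hint
  rw [integral_prod_symm _ hint]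
  refine integral_congr_ae ?_
  filter_upwards [hre] with s hs
  have hpos : 0 < (σ * (ζ s - x)).re := by
    rw [mul_sub, Complex.sub_re, Complex.re_mul_ofReal]
    have hx' : σ.re * x ≤ L * |σ.re| := by
      rw [mul_comm L]
      exact (le_abs_self _).trans ((abs_mul _ _).trans_le
        (mul_le_mul_of_nonneg_left (abs_le.2 (Ioo_subset_Icc_self hx)) (abs_nonneg _)))
    linarith
  rw [div_eq_mul_inv, ← integral_mul_exp_neg_mul_eq_inv hpos, ← integral_const_mul]
  refine integral_congr_ae (.of_forall fun r => ?_)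
  simp only
  rw [mul_assoc, mul_assoc, ← Complex.exp_add]
  congr! 3
  ring

/- With `0 ≤ ε₁ Re ζ` and `0 ≤ ε₂ Im ζ`, the choice `σ = ε₁ - ε₂ β i` gives
`Re (σ ζ) = |Re ζ| + β |Im ζ|` and `Re σ² = 1 - β²`: the first must stay above `L = L |Re σ|` and
the second positive, which `L / r < β < 1` allows. -/
lemma cauchyIntegral_mem_classicallyReachable_of_quadrant [SFinite μ] {ε₁ ε₂ r : ℝ}
    (hg : Integrable g μ) (hζ : AEStronglyMeasurable ζ μ) (hε₁ : |ε₁| = 1) (hε₂ : |ε₂| = 1)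
    (hre : ∀ᵐ s ∂μ, 0 ≤ ε₁ * (ζ s).re) (him : ∀ᵐ s ∂μ, 0 ≤ ε₂ * (ζ s).im)
    (hr : ∀ᵐ s ∂μ, r ≤ |(ζ s).re| + |(ζ s).im|) (hL : 0 ≤ L) (hLr : L < r) (hT : 0 < T) :
    (fun x : ℝ => ∫ s, g s / (ζ s - x) ∂μ) ∈ classicallyReachable L T := by
  obtain ⟨β, hβ, hβ1⟩ := exists_between ((div_lt_one (hL.trans_lt hLr)).2 hLr)
  have hβ0 : 0 ≤ β := (div_nonneg hL (hL.trans hLr.le)).trans hβ.le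
  rw [div_lt_iff₀ (hL.trans_lt hLr)] at hβ
  refine cauchyIntegral_mem_classicallyReachable (σ := ⟨ε₁, -(ε₂ * β)⟩) hg hζ ?_ (sub_pos.2 hβ) ?_
    hL hT
  · calc (0 : ℝ) < 1 - β ^ 2 := sub_pos.2 (pow_lt_one₀ hβ0 hβ1 two_ne_zero)
      _ = |ε₁| ^ 2 - (|ε₂| * β) ^ 2 := by rw [hε₁, hε₂, one_pow, one_mul]
      _ = ((⟨ε₁, -(ε₂ * β)⟩ : ℂ) ^ 2).re := by
        rw [sq, sq, sq, Complex.mul_re, abs_mul_abs_self, mul_mul_mul_comm, abs_mul_abs_self]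
        ring
  · filter_upwards [hre, him, hr] with s hre him hr
    have hre' : ε₁ * (ζ s).re = |(ζ s).re| := by rw [← abs_of_nonneg hre, abs_mul, hε₁, one_mul]
    have him' : ε₂ * (ζ s).im = |(ζ s).im| := by rw [← abs_of_nonneg him, abs_mul, hε₂, one_mul]
    calc β * r - L + L * |ε₁| ≤ β * (|(ζ s).re| + |(ζ s).im|) := by
          rw [hε₁, mul_one, sub_add_cancel]
          gcongr
      _ ≤ |(ζ s).re| + β * |(ζ s).im| := by
          rw [mul_add]
          gcongr
          exact mul_le_of_le_one_left (abs_nonneg _) hβ1.le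
      _ = ((⟨ε₁, -(ε₂ * β)⟩ : ℂ) * ζ s).re := by
          rw [← hre', ← him', Complex.mul_re]
          ring

end CauchyIntegral

section SquareContour

open Complex (I)

/-- The side of the square `[-1, 1]²` obtained from `{Re z = 1}` by `j` quarter turns. -/
noncomputable def unitSquareSide (j : ℕ) (t : ℝ) : ℂ := I ^ j * (1 + t * I)

/-- The contour integral of `f` along the positively oriented boundary of `[-1, 1]²`. -/
noncomputable def unitSquareIntegral (f : ℂ → ℂ) : ℂ :=
  ∑ j ∈ Finset.range 4, ∫ t in (-1 : ℝ)..1, I ^ (j + 1) * f (unitSquareSide j t)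

lemma continuous_unitSquareSide (j : ℕ) : Continuous (unitSquareSide j) := by
  unfold unitSquareSide
  fun_prop

lemma unitSquareSide_succ (j : ℕ) (t : ℝ) : unitSquareSide (j + 1) t = I * unitSquareSide j t := by
  rw [unitSquareSide, unitSquareSide, pow_succ', mul_assoc]

lemma unitSquareSide_mem (j : ℕ) {t : ℝ} (ht : t ∈ Icc (-1) 1) :
    unitSquareSide j t ∈ Icc (-1) 1 ×ℂ Icc (-1) 1 := by
  induction j with
  | zero => simpa [unitSquareSide, Complex.mem_reProdIm] using ht
  | succ j ih =>
    rw [Complex.mem_reProdIm] at ih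
    rw [unitSquareSide_succ, Complex.mem_reProdIm, Complex.I_mul_re, Complex.I_mul_im]
    exact ⟨⟨neg_le_neg ih.2.2, neg_le.1 ih.2.1⟩, ih.1⟩

lemma neg_I_pow_mul_mem {q : ℂ} (hq : q ∈ Ioo (-1) 1 ×ℂ Ioo (-1) 1) (j : ℕ) :
    (-I) ^ j * q ∈ Ioo (-1) 1 ×ℂ Ioo (-1) 1 := by
  induction j with
  | zero => simpa using hq
  | succ j ih =>
    rw [Complex.mem_reProdIm] at ih
    rw [pow_succ', mul_assoc, neg_mul, Complex.mem_reProdIm, Complex.neg_re, Complex.neg_im,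
      Complex.I_mul_re, Complex.I_mul_im, neg_neg]
    exact ⟨ih.2, neg_lt_neg ih.1.2, neg_lt.1 ih.1.1⟩

lemma unitSquareSide_sub (j : ℕ) (t : ℝ) (q : ℂ) :
    unitSquareSide j t - q = I ^ j * (1 + t * I - (-I) ^ j * q) := by
  rw [unitSquareSide, mul_sub, ← mul_assoc (I ^ j) ((-I) ^ j), ← mul_pow, mul_neg, Complex.I_mul_I,
    neg_neg, one_pow, one_mul]

lemma re_one_add_mul_I_sub_pos {q : ℂ} (hq : q ∈ Ioo (-1) 1 ×ℂ Ioo (-1) 1) (t : ℝ) (j : ℕ) :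
    0 < (1 + t * I - (-I) ^ j * q).re := by
  simpa using (neg_I_pow_mul_mem hq j).1.2

lemma unitSquareSide_ne {q : ℂ} (hq : q ∈ Ioo (-1) 1 ×ℂ Ioo (-1) 1) (j : ℕ) (t : ℝ) :
    unitSquareSide j t ≠ q := by
  rw [← sub_ne_zero, unitSquareSide_sub]
  refine mul_ne_zero (pow_ne_zero _ Complex.I_ne_zero) fun h => ?_
  simpa [h] using re_one_add_mul_I_sub_pos hq t j

lemma unitSquareIntegral_eq_zero {f : ℂ → ℂ}
    (hf : DifferentiableOn ℂ f (Icc (-1) 1 ×ℂ Icc (-1) 1)) : unitSquareIntegral f = 0 := by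
  have hright (t : ℝ) : unitSquareSide 0 t = 1 + t * I := by simp [unitSquareSide]
  have htop (t : ℝ) : unitSquareSide 1 t = (-t : ℝ) + I := by
    rw [unitSquareSide, Complex.ofReal_neg]
    linear_combination t * Complex.I_mul_I
  have hleft (t : ℝ) : unitSquareSide 2 t = -1 + (-t : ℝ) * I := by
    rw [unitSquareSide, Complex.I_sq, Complex.ofReal_neg]
    ring
  have hbottom (t : ℝ) : unitSquareSide 3 t = t + -I := by
    rw [unitSquareSide, Complex.I_pow_three]
    linear_combination -t * Complex.I_mul_I
  have hrect := Complex.integral_boundary_rect_eq_zero_of_differentiableOn f (-1 - I) (1 + I)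
    (by simpa [uIcc_of_le] using hf)
  simp only [Complex.sub_re, Complex.neg_re, Complex.one_re, Complex.I_re, sub_zero,
    Complex.add_re, add_zero, Complex.sub_im, Complex.neg_im, Complex.one_im, neg_zero,
    Complex.I_im, zero_sub, Complex.add_im, zero_add, Complex.ofReal_neg, Complex.ofReal_one,
    neg_one_mul, one_mul, smul_eq_mul] at hrect
  simp only [unitSquareIntegral, Finset.sum_range_succ, Finset.sum_range_zero, zero_add,
    intervalIntegral.integral_const_mul, hright, htop, hleft, hbottom,
    intervalIntegral.integral_comp_neg (fun t : ℝ => f (t + I)),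
    intervalIntegral.integral_comp_neg (fun t : ℝ => f (-1 + t * I)), neg_neg, Nat.reduceAdd,
    pow_one, Complex.I_sq, Complex.I_pow_three, Complex.I_pow_four]
  linear_combination hrect

lemma log_I_mul {w : ℂ} (hw : 0 < w.re) :
    Complex.log (I * w) = Complex.log w + Real.pi / 2 * I := by
  have hw0 : w ≠ 0 := by
    rintro rfl
    simp at hw
  have harg := abs_lt.1 (Complex.abs_arg_lt_pi_div_two_iff.2 (Or.inl hw))
  rw [Complex.log_mul Complex.I_ne_zero hw0, Complex.log_I, add_comm]
  rw [Complex.arg_I]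
  constructor <;> linarith [harg.1, harg.2, Real.pi_pos]

lemma integral_unitSquareSide_inv_sub {q : ℂ} (hq : q ∈ Ioo (-1) 1 ×ℂ Ioo (-1) 1) (j : ℕ) :
    ∫ t in (-1 : ℝ)..1, I ^ (j + 1) * (unitSquareSide j t - q)⁻¹ =
      Complex.log (1 + I - (-I) ^ j * q) - Complex.log (1 - I - (-I) ^ j * q) := by
  have hre := fun t => re_one_add_mul_I_sub_pos hq t j
  have hderiv (t : ℝ) : HasDerivAt (fun t : ℝ => Complex.log (1 + t * I - (-I) ^ j * q))
      (I ^ (j + 1) * (unitSquareSide j t - q)⁻¹) t := by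
    have hlin : HasDerivAt (fun t : ℝ => 1 + t * I - (-I) ^ j * q) I t := by
      simpa using ((Complex.ofRealCLM.hasDerivAt (x := t)).mul_const I).const_add 1 |>.sub_const
        ((-I) ^ j * q)
    refine (hlin.clog_real (Or.inl (hre t))).congr_deriv ?_
    rw [unitSquareSide_sub, mul_inv, pow_succ, mul_mul_mul_comm,
      mul_inv_cancel₀ (pow_ne_zero j Complex.I_ne_zero), one_mul, div_eq_mul_inv]
  have hcont : Continuous fun t => I ^ (j + 1) * (unitSquareSide j t - q)⁻¹ :=
    continuous_const.mul (((continuous_unitSquareSide j).sub continuous_const).inv₀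
      fun t => sub_ne_zero.2 (unitSquareSide_ne hq j t))
  rw [intervalIntegral.integral_eq_sub_of_hasDerivAt (fun t _ => hderiv t)
    (hcont.intervalIntegrable _ _)]
  simp [← sub_eq_add_neg]

/- Put `v j = 1 - i - (-i)ʲ q`: the `j`-th side contributes `log (i v (j + 1)) - log (v j)`, and a
quarter turn adds `π i / 2` to the logarithm, so the sum telescopes. -/
lemma unitSquareIntegral_inv_sub {q : ℂ} (hq : q ∈ Ioo (-1) 1 ×ℂ Ioo (-1) 1) :
    unitSquareIntegral (fun z => (z - q)⁻¹) = 2 * Real.pi * I := by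
  let v (j : ℕ) : ℂ := 1 - I - (-I) ^ j * q
  have hside (j : ℕ) : ∫ t in (-1 : ℝ)..1, I ^ (j + 1) * (unitSquareSide j t - q)⁻¹ =
      Complex.log (v (j + 1)) - Complex.log (v j) + Real.pi / 2 * I := by
    have hturn : 1 + I - (-I) ^ j * q = I * v (j + 1) := by
      simp only [v]
      rw [pow_succ]
      linear_combination (1 - (-I) ^ j * q) * Complex.I_mul_I
    have hv : 0 < (v (j + 1)).re := by
      simpa [v] using re_one_add_mul_I_sub_pos hq (-1) (j + 1)
    rw [integral_unitSquareSide_inv_sub hq, hturn, log_I_mul hv]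
    ring
  have hperiod : v 4 = v 0 := by simp [v, Even.neg_pow (show Even 4 by decide)]
  simp only [unitSquareIntegral, hside, Finset.sum_add_distrib,
    Finset.sum_range_sub (fun j => Complex.log (v j)), hperiod, Finset.sum_const, Finset.card_range]
  ring

lemma unitSquareIntegral_div_sub {f : ℂ → ℂ}
    (hf : DifferentiableOn ℂ f (Icc (-1) 1 ×ℂ Icc (-1) 1)) {q : ℂ}
    (hq : q ∈ Ioo (-1) 1 ×ℂ Ioo (-1) 1) :
    unitSquareIntegral (fun z => f z / (z - q)) = 2 * Real.pi * I * f q := by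
  have hnhds : Icc (-1) 1 ×ℂ Icc (-1) 1 ∈ 𝓝 q :=
    mem_of_superset ((isOpen_Ioo.reProdIm isOpen_Ioo).mem_nhds hq)
      (inter_subset_inter (preimage_mono Ioo_subset_Icc_self) (preimage_mono Ioo_subset_Icc_self))
  have hslope := (Complex.differentiableOn_dslope hnhds).2 hf
  have hside (j : ℕ) : ∫ t in (-1 : ℝ)..1, I ^ (j + 1) *
      (f (unitSquareSide j t) / (unitSquareSide j t - q)) =
      (∫ t in (-1 : ℝ)..1, I ^ (j + 1) * dslope f q (unitSquareSide j t)) +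
        f q * ∫ t in (-1 : ℝ)..1, I ^ (j + 1) * (unitSquareSide j t - q)⁻¹ := by
    have hne (t : ℝ) := sub_ne_zero.2 (unitSquareSide_ne hq j t)
    have hcont_slope : ContinuousOn (fun t => I ^ (j + 1) * dslope f q (unitSquareSide j t))
        (uIcc (-1) 1) := by
      rw [uIcc_of_le (by norm_num)]
      exact continuousOn_const.mul (hslope.continuousOn.comp
        (continuous_unitSquareSide j).continuousOn fun t ht => unitSquareSide_mem j ht)
    have hcont_inv : Continuous fun t => I ^ (j + 1) * (unitSquareSide j t - q)⁻¹ :=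
      continuous_const.mul (((continuous_unitSquareSide j).sub continuous_const).inv₀ hne)
    rw [← intervalIntegral.integral_const_mul, ← intervalIntegral.integral_add
      hcont_slope.intervalIntegrable ((hcont_inv.intervalIntegrable _ _).const_mul _)]
    refine intervalIntegral.integral_congr fun t _ => ?_
    simp only [dslope_of_ne f (unitSquareSide_ne hq j t), slope_def_field]
    field [hne t]
  calc unitSquareIntegral (fun z => f z / (z - q))
      = unitSquareIntegral (dslope f q) + f q * unitSquareIntegral fun z => (z - q)⁻¹ := by
        simp only [unitSquareIntegral, hside, Finset.sum_add_distrib, Finset.mul_sum]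
    _ = 2 * Real.pi * I * f q := by
        rw [unitSquareIntegral_eq_zero hslope, unitSquareIntegral_inv_sub hq, zero_add, mul_comm]

lemma abs_re_add_abs_im_one_add_I_mul_le {p : ℂ} (hp : p ∈ Icc (-1) 1 ×ℂ Icc (-1) 1) :
    |((1 + I) * p).re| + |((1 + I) * p).im| ≤ 2 := by
  obtain ⟨⟨hre₁, hre₂⟩, him₁, him₂⟩ := hp
  have hre : ((1 + I) * p).re = p.re - p.im := by simp
  have him : ((1 + I) * p).im = p.im + p.re := by simp
  rw [hre, him]
  rcases abs_cases (p.re - p.im) with h | h <;> rcases abs_cases (p.im + p.re) with h' | h' <;>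
    linarith

lemma exists_quadrant_one_add_I_mul_unitSquareSide (j : ℕ) :
    ∃ ε₁ ε₂ : ℝ, |ε₁| = 1 ∧ |ε₂| = 1 ∧ ∀ t ∈ Icc (-1 : ℝ) 1,
      0 ≤ ε₁ * ((1 + I) * unitSquareSide j t).re ∧ 0 ≤ ε₂ * ((1 + I) * unitSquareSide j t).im ∧
        |((1 + I) * unitSquareSide j t).re| + |((1 + I) * unitSquareSide j t).im| = 2 := by
  induction j with
  | zero =>
    refine ⟨1, 1, abs_one, abs_one, fun t ht => ?_⟩
    have hre : ((1 + I) * unitSquareSide 0 t).re = 1 - t := by simp [unitSquareSide]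
    have him : ((1 + I) * unitSquareSide 0 t).im = 1 + t := by simp [unitSquareSide, add_comm]
    have hre_nonneg : 0 ≤ 1 - t := by linarith [ht.2]
    have him_nonneg : 0 ≤ 1 + t := by linarith [ht.1]
    rw [hre, him, abs_of_nonneg hre_nonneg, abs_of_nonneg him_nonneg]
    exact ⟨by simpa using hre_nonneg, by simpa using him_nonneg, by ring⟩
  | succ j ih =>
    obtain ⟨ε₁, ε₂, hε₁, hε₂, hside⟩ := ih
    refine ⟨-ε₂, ε₁, (abs_neg _).trans hε₂, hε₁, fun t ht => ?_⟩
    obtain ⟨hre, him, hsum⟩ := hside t ht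
    rw [unitSquareSide_succ, mul_left_comm, Complex.I_mul_re, Complex.I_mul_im, neg_mul_neg,
      abs_neg, add_comm |((1 + I) * unitSquareSide j t).im|]
    exact ⟨him, hre, hsum⟩

end SquareContour

section Analytic

open Complex (I)

lemma mul_one_add_I_mul_mem_square {R L₀ : ℝ} (hR : 0 ≤ R) (hRL : 2 * R < L₀) {p : ℂ}
    (hp : p ∈ Icc (-1) 1 ×ℂ Icc (-1) 1) : R * ((1 + I) * p) ∈ square L₀ := by
  rw [square, mem_ofPred_eq, Complex.re_ofReal_mul, Complex.im_ofReal_mul, abs_mul, abs_mul,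
    abs_of_nonneg hR, ← mul_add]
  linarith [mul_le_mul_of_nonneg_left (abs_re_add_abs_im_one_add_I_mul_le hp) hR]

lemma cauchy_formula_diamond {F : ℂ → ℂ} {R L₀ : ℝ} (hR : 0 < R) (hRL : 2 * R < L₀)
    (hF : DifferentiableOn ℂ F (square L₀)) {x : ℝ} (hx : x ∈ Ioo (-(2 * R)) (2 * R)) :
    F x = ∑ j ∈ Finset.range 4, ∫ t in (-1 : ℝ)..1,
      (I ^ (j + 1) * (R * (1 + I)) * (2 * Real.pi * I)⁻¹ *
        F (R * ((1 + I) * unitSquareSide j t))) / (R * ((1 + I) * unitSquareSide j t) - x) := by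
  have h2R : 0 < 2 * R := mul_pos two_pos hR
  let q : ℂ := ⟨x / (2 * R), -(x / (2 * R))⟩
  have hq : q ∈ Ioo (-1) 1 ×ℂ Ioo (-1) 1 := by
    have hlt : x / (2 * R) < 1 := (div_lt_one h2R).2 hx.2
    have hgt : -1 < x / (2 * R) := by
      rw [lt_div_iff₀ h2R, neg_one_mul]
      exact hx.1
    exact ⟨⟨hgt, hlt⟩, neg_lt_neg hlt, neg_lt.1 hgt⟩
  have hqx : R * ((1 + I) * q) = x := by
    apply Complex.ext
    · rw [Complex.re_ofReal_mul, Complex.ofReal_re, Complex.mul_re, Complex.add_re, Complex.add_im,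
        Complex.one_re, Complex.one_im, Complex.I_re, Complex.I_im]
      field
    · simp [q]
  have hcauchy := unitSquareIntegral_div_sub (f := fun p => F (R * ((1 + I) * p)))
    (hF.comp (by fun_prop) fun p hp => mul_one_add_I_mul_mem_square hR.le hRL hp) hq
  rw [hqx, unitSquareIntegral] at hcauchy
  have hterm (j : ℕ) (t : ℝ) : I ^ (j + 1) * (R * (1 + I)) * (2 * Real.pi * I)⁻¹ *
        F (R * ((1 + I) * unitSquareSide j t)) / (R * ((1 + I) * unitSquareSide j t) - x) =
      (2 * Real.pi * I)⁻¹ * (I ^ (j + 1) *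
        (F (R * ((1 + I) * unitSquareSide j t)) / (unitSquareSide j t - q))) := by
    have hR0 : (R : ℂ) ≠ 0 := Complex.ofReal_ne_zero.2 hR.ne'
    have hI : 1 + I ≠ 0 := fun h => by simpa using congrArg Complex.re h
    have hne := sub_ne_zero.2 (unitSquareSide_ne hq j t)
    rw [← hqx, ← mul_sub, ← mul_sub]
    field_simp
  simp only [hterm, intervalIntegral.integral_const_mul, ← Finset.mul_sum]
  simp only [intervalIntegral.integral_const_mul] at hcauchy
  rw [hcauchy, inv_mul_cancel_left₀ Complex.two_pi_I_ne_zero]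

lemma mem_classicallyReachable_of_differentiableOn {L L₀ T : ℝ} (hL : 0 < L) (hL₀ : L < L₀)
    (hT : 0 < T) {F : ℂ → ℂ} (hF : DifferentiableOn ℂ F (square L₀)) :
    (fun x : ℝ => F x) ∈ classicallyReachable L T := by
  let R := (L + L₀) / 4
  have hR : 0 < R := by simp only [R]; linarith
  have hLR : L < 2 * R := by simp only [R]; linarith
  have hRL : 2 * R < L₀ := by simp only [R]; linarith
  let ζ (j : ℕ) (t : ℝ) : ℂ := R * ((1 + I) * unitSquareSide j t)
  let g (j : ℕ) (t : ℝ) : ℂ := I ^ (j + 1) * (R * (1 + I)) * (2 * Real.pi * I)⁻¹ * F (ζ j t)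
  have hζ (j : ℕ) : Continuous (ζ j) :=
    continuous_const.mul (continuous_const.mul (continuous_unitSquareSide j))
  have hside (j : ℕ) : (fun x : ℝ => ∫ t in Ioc (-1 : ℝ) 1, g j t / (ζ j t - x)) ∈
      classicallyReachable L T := by
    have hg : IntegrableOn (g j) (Ioc (-1) 1) :=
      (ContinuousOn.integrableOn_Icc (continuousOn_const.mul (hF.continuousOn.comp
        (hζ j).continuousOn fun t ht => mul_one_add_I_mul_mem_square hR.le hRL
          (unitSquareSide_mem j ht)))).mono_set Ioc_subset_Icc_self
    obtain ⟨ε₁, ε₂, hε₁, hε₂, hquad⟩ := exists_quadrant_one_add_I_mul_unitSquareSide j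
    have hmem : ∀ᵐ t ∂volume.restrict (Ioc (-1 : ℝ) 1), t ∈ Icc (-1 : ℝ) 1 :=
      (ae_restrict_mem measurableSet_Ioc).mono fun t ht => Ioc_subset_Icc_self ht
    refine cauchyIntegral_mem_classicallyReachable_of_quadrant hg (hζ j).aestronglyMeasurable
      hε₁ hε₂ (hmem.mono fun t ht => ?_) (hmem.mono fun t ht => ?_) (hmem.mono fun t ht => ?_)
      hL.le hLR hT
    · rw [Complex.re_ofReal_mul, mul_left_comm]
      exact mul_nonneg hR.le (hquad t ht).1
    · rw [Complex.im_ofReal_mul, mul_left_comm]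
      exact mul_nonneg hR.le (hquad t ht).2.1
    · rw [Complex.re_ofReal_mul, Complex.im_ofReal_mul, abs_mul, abs_mul, abs_of_pos hR, ← mul_add,
        (hquad t ht).2.2, mul_comm]
  refine (classicallyReachable_congr fun x hx => ?_).1
    (Submodule.sum_mem _ fun j (_ : j ∈ Finset.range 4) => hside j)
  rw [Finset.sum_apply, cauchy_formula_diamond hR hRL hF
    (Ioo_subset_Ioo (neg_le_neg hLR.le) hLR.le hx)]
  exact Finset.sum_congr rfl fun j _ =>
    (intervalIntegral.integral_of_le (by norm_num)).symm

end Analytic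

end HeatReach

theorem theorem1 (L T : ℝ) (hL : 0 < L) (hT : 0 < T) :
    (⋃ L₀ ∈ Set.Ioi L, HeatReach.analyticStates L L₀) ⊆ HeatReach.reachableSet L T := by
  intro f hf
  obtain ⟨L₀, hL₀, F, hF, hfF⟩ := Set.mem_iUnion₂.1 hf
  exact HeatReach.mem_reachableSet_of_mem_classicallyReachable hL.le hT.le
    (HeatReach.mem_classicallyReachable_of_differentiableOn hL hL₀ hT hF.differentiableOn) hfF
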